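/- Let $d\ge 0$ be an integer and $K>0$. Let $n\ge 2$, let $x_1,\dots,x_n\in\mathbb R^d$ be deterministic points, let $m:\mathbb R^d\to\mathbb R$ be measurable, $\mu_i=m(x_i)$, $\mu=(\mu_1,\dots,\mu_n)$ and $y_i=\mu_i+\epsilon_i$, where $\epsilon_1,\dots,\epsilon_n$ are i.i.d. real random variables with $\mathbb E\,\epsilon_i=0$ and $\mathbb E\exp(\epsilon_i^2/K)\le 2$. For $1\le k\le n-1$ let $N_k(i)$ be the set of indices of the $k$ nearest neighbours (in Euclidean distance) of $x_i$ among the $x_j$, $j\ne i$. Ties may be broken by any random rule that is independent of the noise, with one restriction which is void if the points are pairwise distinct: among points that coincide with $x_i$, those with $|z_j-z_i|$ smallest are preferred, where $z_1,\dots,z_n$ are pairwise distinct real labels (possibly random and depending on $k$), for example i.i.d. uniform on $[0,1]$. Put $$\mathrm{MSE}(k)=\mathbb E\Big[\frac1n\sum_{i=1}^n\Big(\mu_i-\frac1k\sum_{j\in N_k(i)}y_j\Big)^2\Big],\qquad f(k)=\frac1n\sum_{i=1}^n\Big(y_i-\frac1k\sum_{j\in N_k(i)}y_j\Big)^2,$$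 where the expectation is over the $\epsilon_i$ only, for given neighbour sets. Let $k^*$ be any minimiser of $\mathrm{MSE}$ and $\tilde k$ any minimiser of $f$ over $1\le k\le n-1$ (the LOOCV choice). Then there are positive constants $A,B,C$ depending only on $d$ and $K$ such that, for all $n\ge2$, all data as above and all $t\ge 0$, $$\mathbb P\big(|\mathrm{MSE}(k^*)-\mathrm{MSE}(\tilde k)|\ge t\big)\le 4n\exp(-n\min\{At^2,Bt\})+4n\exp(-Cn^2t^2/\|\mu\|^2),$$ where the last term is omitted if $\mu=0$. In particular, when $\|\mu\|^2=O(n)$, the gap is $O(\sqrt{\log n/n})$ with high probability: for all real $M,p$ there is $L>0$ depending only on $d,K,M,p$ such that, for all $n\ge 2$ and all data as above with $\|\mu\|^2\le Mn$, $$\mathbb P\Big(|\mathrm{MSE}(k^*)-\mathrm{MSE}(\tilde k)|\ge L\sqrt{\log n/n}\Big)\le n^{-p}.$$ -/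

import Mathlib

open MeasureTheory ProbabilityTheory

/-- `N i` is, for every `i`, the index set of `k` nearest neighbours of `x i` among the other
design points. Ties between distinct points may be broken in any way. Ties between points that
coincide with `x i` are broken by labels `z`: the points whose labels are closest to the label of
`i` are preferred. If the design points are pairwise distinct, `tie` says nothing. -/
structure IsNeighborSystem {d n : ℕ} (x : Fin n → EuclideanSpace ℝ (Fin d)) (k : ℕ)
    (N : Fin n → Finset (Fin n)) : Prop where
  notMem_self : ∀ i, i ∉ N i
  card_eq : ∀ i, (N i).card = k
  nearest : ∀ i, ∀ j ∈ N i, ∀ l, l ∉ N i → l ≠ i → dist (x i) (x j) ≤ dist (x i) (x l)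
  tie : ∃ z : Fin n → ℝ, Function.Injective z ∧
    ∀ i, ∀ j ∈ N i, ∀ l, l ∉ N i → l ≠ i → x j = x i → x l = x i → |z i - z j| ≤ |z i - z l|

/-- The `k`-NN regression estimate at the `i`-th design point, from the responses `y`. -/
noncomputable def knnEstimate {n : ℕ} (N : Fin n → Finset (Fin n)) (k : ℕ) (y : Fin n → ℝ)
    (i : Fin n) : ℝ :=
  (1 / (k : ℝ)) * ∑ j ∈ N i, y j

/-- The mean squared error; the expectation is over the noise `ε` only, for given neighbour
sets `N`. -/
noncomputable def knnMSE {Ω : Type*} [MeasurableSpace Ω] (P : Measure Ω) {n : ℕ}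
    (mu : Fin n → ℝ) (ε : Fin n → Ω → ℝ) (N : ℕ → Fin n → Finset (Fin n)) (k : ℕ) : ℝ :=
  ∫ ω, (1 / (n : ℝ)) * ∑ i, (mu i - knnEstimate (N k) k (fun j => mu j + ε j ω) i) ^ 2 ∂P

/-- The empirical leave-one-out residual `f(k)` of the responses `y`. -/
noncomputable def looResidual {n : ℕ} (y : Fin n → ℝ) (N : ℕ → Fin n → Finset (Fin n))
    (k : ℕ) : ℝ :=
  (1 / (n : ℝ)) * ∑ i, (y i - knnEstimate (N k) k y i) ^ 2

/-- `k` is a minimiser of `F` over `1, …, n - 1`. -/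
def IsArgminNumber (n : ℕ) (F : ℕ → ℝ) (k : ℕ) : Prop :=
  k ∈ Finset.Icc 1 (n - 1) ∧ ∀ l ∈ Finset.Icc 1 (n - 1), F k ≤ F l

/-- Fixed-design `k`-NN regression `y i = m (x i) + ε i`, with i.i.d. centred noise satisfying
`E exp (ε² / K) ≤ 2`, with neighbour sets `N ω k i` whose ties are broken by means of randomness
that is independent of the noise, and with the oracle choice `kstar` and the leave-one-out
cross-validation choice `ktilde` (arbitrary minimisers, if there are several). -/
structure IsKNNRegression {Ω : Type*} [MeasurableSpace Ω] (P : Measure Ω) {d n : ℕ} (K : ℝ)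
    (x : Fin n → EuclideanSpace ℝ (Fin d)) (m : EuclideanSpace ℝ (Fin d) → ℝ)
    (ε : Fin n → Ω → ℝ) (N : Ω → ℕ → Fin n → Finset (Fin n)) (kstar ktilde : Ω → ℕ) : Prop where
  measurable_m : Measurable m
  indep : iIndepFun ε P
  identDistrib : ∀ i j, IdentDistrib (ε i) (ε j) P P
  mean_zero : ∀ i, ∫ ω, ε i ω ∂P = 0
  integrable_exp : ∀ i, Integrable (fun ω => Real.exp (ε i ω ^ 2 / K)) P
  exp_le : ∀ i, ∫ ω, Real.exp (ε i ω ^ 2 / K) ∂P ≤ 2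
  measurable_N : Measurable N
  indep_N : IndepFun N (fun ω i => ε i ω) P
  neighbors : ∀ᵐ ω ∂P, ∀ k ∈ Finset.Icc 1 (n - 1), IsNeighborSystem x k (N ω k)
  argmin_kstar : ∀ᵐ ω ∂P, IsArgminNumber n (knnMSE P (fun i => m (x i)) ε (N ω)) (kstar ω)
  argmin_ktilde : ∀ᵐ ω ∂P,
    IsArgminNumber n (looResidual (fun i => m (x i) + ε i ω) (N ω)) (ktilde ω)

/-- The gap `|MSE(k*) - MSE(k̃)|`. -/
noncomputable def mseGap {Ω : Type*} [MeasurableSpace Ω] (P : Measure Ω) {n : ℕ}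
    (mu : Fin n → ℝ) (ε : Fin n → Ω → ℝ) (N : Ω → ℕ → Fin n → Finset (Fin n))
    (kstar ktilde : Ω → ℕ) (ω : Ω) : ℝ :=
  |knnMSE P mu ε (N ω) (kstar ω) - knnMSE P mu ε (N ω) (ktilde ω)|

open Classical in
/-- `exp (-C n² t² / ‖μ‖²)` for the Euclidean norm, with the value `exp (-∞) = 0` at `μ = 0`. -/
noncomputable def signalTail {n : ℕ} (C t : ℝ) (mu : Fin n → ℝ) : ℝ :=
  if mu = 0 then 0 else Real.exp (-(C * (n : ℝ) ^ 2 * t ^ 2 / ∑ i, mu i ^ 2))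

/-!
Write `y = μ + e` and let `W` be the weight matrix of the `k`-NN estimate. As `W` has zero
diagonal, the residual satisfies
`‖(1 - W) y‖² - ‖e‖² = ‖(1 - W) μ‖² + 2 ⟪(1 - W)ᵀ (1 - W) μ, e⟫ + ⟪(Wᵀ W - 2 W) e, e⟫`,
and its mean is `n * MSE(k)` (`sum_residual_sq_eq`, `IsSmoother.integral_sum_sub_sq`). The term
`‖e‖²` is the same for all `k`, so that a gap of `t` between the two minimisers forces the centred
right-hand side to deviate by `n t / 2` for some `k` (`half_le_abs_of_argmin`), and a union bound
over `k` remains.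

The operator norm of `W` is bounded in terms of the dimension alone. Its rows sum to one, and its
columns have bounded sums, since a point is a near neighbour of at most `c k` others: this is a
covering by narrow cones (`exists_card_filter_mem_neighbors_le`); Schur's test `sum_sq_sum_mul_le`
does the rest. The linear form is then sub-Gaussian, and the quadratic form obeys a Hanson-Wright
inequality (`IsSubgaussianLaw.measureReal_quadraticForm_le`). Only the operator norm enters the
latter: the diagonal is a sum of independent sub-exponential variables, and the rest is decoupled
by averaging over subsets `I` of the index set (`offDiag_eq_sum_subsets`). Conditionally on the
coordinates outside `I`, the decoupled form is linear in those in `I`, and integrating these out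
leaves at most the exponential of a small multiple of `‖e‖²`.

The neighbour sets take finitely many values and are independent of the noise, so that the bound for
fixed neighbour sets carries over (`measureReal_le_of_indepFun_discrete`).
-/

/-! ### Sub-Gaussian laws on the line -/

/-- A centred law `ν` on the line with `∫ exp (u² / K) dν ≤ 2`, i.e. with `ψ₂`-norm at
most `√K`. -/
structure IsSubgaussianLaw (K : ℝ) (ν : Measure ℝ) : Prop where
  mean_zero : ∫ u, u ∂ν = 0
  integrable_exp : Integrable (fun u => Real.exp (u ^ 2 / K)) ν
  exp_le : ∫ u, Real.exp (u ^ 2 / K) ∂ν ≤ 2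

theorem exp_le_self_add_exp_sq (x : ℝ) : Real.exp x ≤ x + Real.exp (x ^ 2) := by
  have h2 := Real.add_one_le_exp (x ^ 2)
  rcases le_or_gt |x| 1 with h | h
  · have := (abs_le.1 (Real.abs_exp_sub_one_sub_id_le h)).2
    linarith
  · rcases lt_abs.1 h with h | h
    · have : Real.exp x ≤ Real.exp (x ^ 2) := Real.exp_le_exp.2 (by nlinarith)
      linarith
    · have : Real.exp x ≤ 1 := Real.exp_le_one_iff.2 (by linarith)
      nlinarith

theorem exp_le_one_add_add_sq_mul_exp_abs (x : ℝ) :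
    Real.exp x ≤ 1 + x + x ^ 2 * Real.exp |x| := by
  have h1 : 1 ≤ Real.exp |x| := Real.one_le_exp (abs_nonneg x)
  rcases le_or_gt |x| 1 with h | h
  · have := (abs_le.1 (Real.abs_exp_sub_one_sub_id_le h)).2
    nlinarith [sq_nonneg x]
  · rcases lt_abs.1 h with h | h
    · have h3 : Real.exp x ≤ x ^ 2 * Real.exp x :=
        le_mul_of_one_le_left (Real.exp_nonneg x) (by nlinarith)
      rw [abs_of_pos (by linarith)]
      linarith
    · have : Real.exp x ≤ 1 := Real.exp_le_one_iff.2 (by linarith)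
      nlinarith [sq_nonneg x]

theorem lintegral_ofReal_le_of_integral_le {α : Type*} [MeasurableSpace α] {ν : Measure α}
    {f g : α → ℝ} {c : ℝ} (hfg : ∀ u, f u ≤ g u) (hg0 : ∀ u, 0 ≤ g u) (hg : Integrable g ν)
    (hc : ∫ u, g u ∂ν ≤ c) : ∫⁻ u, ENNReal.ofReal (f u) ∂ν ≤ ENNReal.ofReal c :=
  calc ∫⁻ u, ENNReal.ofReal (f u) ∂ν ≤ ∫⁻ u, ENNReal.ofReal (g u) ∂ν :=
        lintegral_mono fun u => ENNReal.ofReal_le_ofReal (hfg u)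
    _ = ENNReal.ofReal (∫ u, g u ∂ν) :=
        (ofReal_integral_eq_lintegral_ofReal hg (ae_of_all _ hg0)).symm
    _ ≤ ENNReal.ofReal c := ENNReal.ofReal_le_ofReal hc

namespace IsSubgaussianLaw

variable {K : ℝ} {ν : Measure ℝ}

theorem integrable_sq (h : IsSubgaussianLaw K ν) (hK : 0 < K) :
    Integrable (fun u => u ^ 2) ν := by
  refine Integrable.mono' (h.integrable_exp.const_mul K) (by fun_prop) (ae_of_all _ fun u => ?_)
  rw [Real.norm_of_nonneg (sq_nonneg u)]
  have := Real.add_one_le_exp (u ^ 2 / K)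
  calc u ^ 2 = K * (u ^ 2 / K) := by field_simp
    _ ≤ K * Real.exp (u ^ 2 / K) := by gcongr; linarith

theorem memLp_two (h : IsSubgaussianLaw K ν) (hK : 0 < K) : MemLp (fun u : ℝ => u) 2 ν :=
  (memLp_two_iff_integrable_sq (by fun_prop)).2 (h.integrable_sq hK)

theorem integrable_id [IsProbabilityMeasure ν] (h : IsSubgaussianLaw K ν) (hK : 0 < K) :
    Integrable (fun u : ℝ => u) ν :=
  (h.memLp_two hK).integrable (by norm_num)

theorem integral_sq_le [IsProbabilityMeasure ν] (h : IsSubgaussianLaw K ν) (hK : 0 < K) :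
    ∫ u, u ^ 2 ∂ν ≤ K := by
  have h1 : ∫ u, u ^ 2 ∂ν ≤ ∫ u, K * (Real.exp (u ^ 2 / K) - 1) ∂ν := by
    refine integral_mono (h.integrable_sq hK)
      ((h.integrable_exp.sub (integrable_const 1)).const_mul K) fun u => ?_
    have := Real.add_one_le_exp (u ^ 2 / K)
    calc u ^ 2 = K * (u ^ 2 / K) := by field_simp
      _ ≤ K * (Real.exp (u ^ 2 / K) - 1) := by gcongr; linarith
  rw [integral_const_mul, integral_sub h.integrable_exp (integrable_const 1)] at h1
  have := h.exp_le
  simp at h1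
  nlinarith

theorem _root_.exp_mul_sq_div_le (u : ℝ) {θ : ℝ} (h0 : 0 ≤ θ) (h1 : θ ≤ 1) :
    Real.exp (θ * (u ^ 2 / K)) ≤ (1 - θ) + θ * Real.exp (u ^ 2 / K) := by
  have := convexOn_exp.2 (Set.mem_univ 0) (Set.mem_univ (u ^ 2 / K)) (sub_nonneg.2 h1) h0
    (by ring)
  simpa using this

theorem integrable_exp_mul_sq [IsProbabilityMeasure ν] (h : IsSubgaussianLaw K ν) {θ : ℝ}
    (h0 : 0 ≤ θ) (h1 : θ ≤ 1) : Integrable (fun u => Real.exp (θ * (u ^ 2 / K))) ν := by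
  refine Integrable.mono' ((integrable_const (1 - θ)).add (h.integrable_exp.const_mul θ))
    (by fun_prop) (ae_of_all _ fun u => ?_)
  rw [Real.norm_of_nonneg (Real.exp_nonneg _)]
  exact exp_mul_sq_div_le u h0 h1

theorem integral_exp_mul_sq_le [IsProbabilityMeasure ν] (h : IsSubgaussianLaw K ν) {θ : ℝ}
    (h0 : 0 ≤ θ) (h1 : θ ≤ 1) : ∫ u, Real.exp (θ * (u ^ 2 / K)) ∂ν ≤ Real.exp θ := by
  have h2 : ∫ u, Real.exp (θ * (u ^ 2 / K)) ∂ν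
      ≤ ∫ u, ((1 - θ) + θ * Real.exp (u ^ 2 / K)) ∂ν :=
    integral_mono (h.integrable_exp_mul_sq h0 h1)
      ((integrable_const _).add (h.integrable_exp.const_mul θ))
      fun u => exp_mul_sq_div_le u h0 h1
  rw [integral_add (integrable_const _) (h.integrable_exp.const_mul θ), integral_const_mul] at h2
  have := h.exp_le
  have := Real.add_one_le_exp θ
  simp at h2
  nlinarith

theorem lintegral_exp_mul_sq_le [IsProbabilityMeasure ν] (h : IsSubgaussianLaw K ν) {θ : ℝ}
    (h0 : 0 ≤ θ) (h1 : θ ≤ 1) :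
    ∫⁻ u, ENNReal.ofReal (Real.exp (θ * (u ^ 2 / K))) ∂ν ≤ ENNReal.ofReal (Real.exp θ) :=
  lintegral_ofReal_le_of_integral_le (fun _ => le_rfl) (fun _ => Real.exp_nonneg _)
    (h.integrable_exp_mul_sq h0 h1) (h.integral_exp_mul_sq_le h0 h1)

/-- The sub-Gaussian bound on the moment generating function. -/
theorem lintegral_exp_mul_le [IsProbabilityMeasure ν] (h : IsSubgaussianLaw K ν) (hK : 0 < K)
    (s : ℝ) :
    ∫⁻ u, ENNReal.ofReal (Real.exp (s * u)) ∂ν ≤ ENNReal.ofReal (Real.exp (K * s ^ 2)) := by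
  have hs0 : 0 ≤ K * s ^ 2 := by positivity
  rcases le_or_gt (K * s ^ 2) 1 with hs | hs
  · -- The linear term of `exp v ≤ v + exp (v ^ 2)` integrates to zero.
    have hi := h.integrable_exp_mul_sq hs0 hs
    refine lintegral_ofReal_le_of_integral_le
      (g := fun u => s * u + Real.exp (K * s ^ 2 * (u ^ 2 / K))) (fun u => ?_) (fun u => ?_)
      (((h.integrable_id hK).const_mul s).add hi) ?_
    · have := exp_le_self_add_exp_sq (s * u)
      rwa [show (s * u) ^ 2 = K * s ^ 2 * (u ^ 2 / K) by field_simp] at this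
    · have := exp_le_self_add_exp_sq (s * u)
      rw [show (s * u) ^ 2 = K * s ^ 2 * (u ^ 2 / K) by field_simp] at this
      exact (Real.exp_nonneg _).trans this
    · rw [integral_add ((h.integrable_id hK).const_mul s) hi, integral_const_mul, h.mean_zero]
      simpa using h.integral_exp_mul_sq_le hs0 hs
  · -- For large `s`, the inequality `2 s u ≤ K s² + u² / K` suffices.
    have hi := (h.integrable_exp_mul_sq (θ := 1 / 2) (by norm_num) (by norm_num)).const_mul
      (Real.exp (K * s ^ 2 / 2))
    refine lintegral_ofReal_le_of_integral_le
      (g := fun u => Real.exp (K * s ^ 2 / 2) * Real.exp (1 / 2 * (u ^ 2 / K)))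
      (fun u => ?_) (fun u => by positivity) hi ?_
    · rw [← Real.exp_add]
      refine Real.exp_le_exp.2 ?_
      have : 0 ≤ (K * s - u) ^ 2 / K := by positivity
      have h3 : (K * s - u) ^ 2 / K = K * s ^ 2 - 2 * (s * u) + u ^ 2 / K := by
        field_simp; ring
      linarith
    · rw [integral_const_mul]
      calc _ ≤ Real.exp (K * s ^ 2 / 2) * Real.exp (1 / 2) := by
            gcongr
            exact h.integral_exp_mul_sq_le (by norm_num) (by norm_num)
        _ ≤ _ := by
            rw [← Real.exp_add]
            exact Real.exp_le_exp.2 (by linarith)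

/-- The squares are sub-exponential: a Bernstein bound for `u ^ 2 - ∫ u ^ 2`. -/
theorem lintegral_exp_mul_sq_sub_le [IsProbabilityMeasure ν] (h : IsSubgaussianLaw K ν)
    (hK : 0 < K) {s : ℝ} (hs : |s| ≤ 1 / (2 * K)) :
    ∫⁻ u, ENNReal.ofReal (Real.exp (s * (u ^ 2 - ∫ v, v ^ 2 ∂ν))) ∂ν
      ≤ ENNReal.ofReal (Real.exp (48 * K ^ 2 * s ^ 2)) := by
  set σ := ∫ v, v ^ 2 ∂ν with hσ
  have hσ0 : 0 ≤ σ := integral_nonneg fun u => sq_nonneg u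
  have hσK : σ ≤ K := h.integral_sq_le hK
  have key : ∀ u : ℝ, Real.exp (s * (u ^ 2 - σ)) ≤
      1 + s * (u ^ 2 - σ) + 24 * K ^ 2 * s ^ 2 * Real.exp (u ^ 2 / K) := by
    intro u
    -- Half of the available exponential moment of `|u ^ 2 - σ| / K` absorbs the quadratic factor.
    set w := |u ^ 2 - σ| / (2 * K) with hw
    have hw0 : 0 ≤ w := by positivity
    have hy : |u ^ 2 - σ| = 2 * K * w := by rw [hw]; field_simp
    have hu : |s * (u ^ 2 - σ)| ≤ w := by
      rw [abs_mul, hw, div_eq_mul_one_div, mul_comm]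
      gcongr
    have hsq : (s * (u ^ 2 - σ)) ^ 2 = 4 * K ^ 2 * s ^ 2 * w ^ 2 := by
      rw [mul_pow, ← sq_abs (u ^ 2 - σ), hy]; ring
    have hw2 : w ^ 2 ≤ 2 * Real.exp w := by
      have := Real.quadratic_le_exp_of_nonneg hw0
      linarith
    have h2w : 2 * w ≤ u ^ 2 / K + 1 := by
      have h4 : |u ^ 2 - σ| ≤ u ^ 2 + K := by
        rw [abs_le]; constructor <;> nlinarith [sq_nonneg u]
      calc 2 * w = |u ^ 2 - σ| / K := by rw [hw]; field_simp
        _ ≤ (u ^ 2 + K) / K := by gcongr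
        _ = u ^ 2 / K + 1 := by field_simp
    have hexp1 : Real.exp 1 ≤ 3 := by have := Real.exp_one_lt_d9; linarith
    calc Real.exp (s * (u ^ 2 - σ))
        ≤ 1 + s * (u ^ 2 - σ) + (s * (u ^ 2 - σ)) ^ 2 * Real.exp |s * (u ^ 2 - σ)| :=
          exp_le_one_add_add_sq_mul_exp_abs _
      _ ≤ 1 + s * (u ^ 2 - σ) + 4 * K ^ 2 * s ^ 2 * (2 * Real.exp w) * Real.exp w := by
          rw [hsq]; gcongr
      _ = 1 + s * (u ^ 2 - σ) + 8 * K ^ 2 * s ^ 2 * Real.exp (2 * w) := by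
          rw [two_mul w, Real.exp_add]; ring
      _ ≤ 1 + s * (u ^ 2 - σ) + 8 * K ^ 2 * s ^ 2 * (Real.exp (u ^ 2 / K) * 3) := by
          gcongr
          calc Real.exp (2 * w) ≤ Real.exp (u ^ 2 / K + 1) := Real.exp_le_exp.2 h2w
            _ = Real.exp (u ^ 2 / K) * Real.exp 1 := Real.exp_add _ _
            _ ≤ _ := by gcongr
      _ = _ := by ring
  have hi1 : Integrable (fun u => s * (u ^ 2 - σ)) ν :=
    ((h.integrable_sq hK).sub (integrable_const σ)).const_mul s
  have hi2 := h.integrable_exp.const_mul (24 * K ^ 2 * s ^ 2)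
  refine lintegral_ofReal_le_of_integral_le key (fun u => (Real.exp_nonneg _).trans (key u))
    (((integrable_const 1).add hi1).add hi2) ?_
  have hi12 : Integrable (fun u => 1 + s * (u ^ 2 - σ)) ν := (integrable_const 1).add hi1
  rw [integral_add hi12 hi2, integral_add (integrable_const 1) hi1,
    integral_const_mul, integral_const_mul, integral_sub (h.integrable_sq hK) (integrable_const σ)]
  have h5 := h.exp_le
  have h6 := Real.add_one_le_exp (48 * K ^ 2 * s ^ 2)
  have h7 : 24 * K ^ 2 * s ^ 2 * ∫ u, Real.exp (u ^ 2 / K) ∂ν ≤ 24 * K ^ 2 * s ^ 2 * 2 := by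
    gcongr
  simp [← hσ]
  linarith

end IsSubgaussianLaw

/-! ### Product measures -/

section ProductMeasure

variable {ι : Type*} [Fintype ι] {ν : Measure ℝ} [IsProbabilityMeasure ν]

/-- Integrating out the `i`-th coordinate: if `∫ exp (φ x u) dν(u) ≤ exp (B x)`, where none of
`φ · u`, `B`, `h` depends on the `i`-th coordinate, then `φ x (x i)` may be replaced by `B x`. -/
theorem lintegral_exp_add_le [DecidableEq ι] {i : ι} {h B : (ι → ℝ) → ℝ}
    {φ : (ι → ℝ) → ℝ → ℝ} (hh : Measurable h) (hB : Measurable B)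
    (hφ : Measurable fun x => φ x (x i))
    (hhi : ∀ x u, h (Function.update x i u) = h x)
    (hBi : ∀ x u, B (Function.update x i u) = B x)
    (hφi : ∀ x u v, φ (Function.update x i u) v = φ x v)
    (hle : ∀ x, ∫⁻ u, ENNReal.ofReal (Real.exp (φ x u)) ∂ν ≤ ENNReal.ofReal (Real.exp (B x))) :
    ∫⁻ x, ENNReal.ofReal (Real.exp (h x + φ x (x i))) ∂(Measure.pi fun _ : ι => ν) ≤
      ∫⁻ x, ENNReal.ofReal (Real.exp (h x + B x)) ∂(Measure.pi fun _ : ι => ν) := by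
  refine lintegral_le_of_lmarginal_le {i} (hh.add hφ).exp.ennreal_ofReal
    (hh.add hB).exp.ennreal_ofReal fun x => ?_
  rw [lmarginal_singleton, lmarginal_singleton]
  simp only [hhi, hBi, hφi, Function.update_self, lintegral_const, measure_univ, mul_one,
    Real.exp_add, ENNReal.ofReal_mul (Real.exp_nonneg _)]
  rw [lintegral_const_mul' _ _ ENNReal.ofReal_ne_top]
  gcongr
  exact hle x

/-- Integrating out the coordinates in `J`, given the others. -/
theorem lintegral_exp_sum_le (J : Finset ι) {B : ι → (ι → ℝ) → ℝ}
    {φ : ι → (ι → ℝ) → ℝ → ℝ} (hB : ∀ i, Measurable (B i))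
    (hφ : ∀ i, Measurable fun x => φ i x (x i))
    (hBi : ∀ i ∈ J, ∀ x y, (∀ j ∉ J, x j = y j) → B i x = B i y)
    (hφi : ∀ i ∈ J, ∀ x y, (∀ j ∉ J, x j = y j) → ∀ v, φ i x v = φ i y v)
    (hle : ∀ i ∈ J, ∀ x,
      ∫⁻ u, ENNReal.ofReal (Real.exp (φ i x u)) ∂ν ≤ ENNReal.ofReal (Real.exp (B i x))) :
    ∫⁻ x, ENNReal.ofReal (Real.exp (∑ i ∈ J, φ i x (x i))) ∂(Measure.pi fun _ : ι => ν) ≤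
      ∫⁻ x, ENNReal.ofReal (Real.exp (∑ i ∈ J, B i x)) ∂(Measure.pi fun _ : ι => ν) := by
  classical
  have hup : ∀ i ∈ J, ∀ (x : ι → ℝ) (u : ℝ), ∀ j ∉ J, Function.update x i u j = x j := by
    intro i hi x u j hj
    exact Function.update_of_ne (ne_of_mem_of_not_mem hi hj).symm _ _
  suffices H : ∀ T ⊆ J, ∀ h : (ι → ℝ) → ℝ, Measurable h →
      (∀ i ∈ T, ∀ x u, h (Function.update x i u) = h x) →
      ∫⁻ x, ENNReal.ofReal (Real.exp (h x + ∑ i ∈ T, φ i x (x i))) ∂(Measure.pi fun _ : ι => ν) ≤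
      ∫⁻ x, ENNReal.ofReal (Real.exp (h x + ∑ i ∈ T, B i x)) ∂(Measure.pi fun _ : ι => ν) by
    simpa using H J subset_rfl (fun _ => 0) measurable_const (fun _ _ _ _ => rfl)
  intro T
  induction T using Finset.induction with
  | empty => intro _ h _ _; simp
  | insert i T hiT ih =>
    intro hT h hh hhT
    have hiJ : i ∈ J := hT (Finset.mem_insert_self i T)
    have hTJ : T ⊆ J := (Finset.subset_insert i T).trans hT
    simp only [Finset.sum_insert hiT]
    calc _ = ∫⁻ x, ENNReal.ofReal (Real.exp ((h x + ∑ j ∈ T, φ j x (x j)) + φ i x (x i)))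
          ∂(Measure.pi fun _ : ι => ν) := by
          congr 1 with x; congr 2; ring
      _ ≤ ∫⁻ x, ENNReal.ofReal (Real.exp ((h x + ∑ j ∈ T, φ j x (x j)) + B i x))
          ∂(Measure.pi fun _ : ι => ν) := by
          refine lintegral_exp_add_le (hh.add (Finset.measurable_sum _ fun j _ => hφ j)) (hB i)
            (hφ i) (fun x u => ?_) (fun x u => hBi i hiJ _ _ (hup i hiJ x u))
            (fun x u v => hφi i hiJ _ _ (hup i hiJ x u) v) (hle i hiJ)
          rw [hhT i (Finset.mem_insert_self i T) x u]
          congr 1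
          refine Finset.sum_congr rfl fun j hj => ?_
          rw [hφi j (hTJ hj) _ _ (hup i hiJ x u),
            Function.update_of_ne (ne_of_mem_of_not_mem hj hiT)]
      _ = ∫⁻ x, ENNReal.ofReal (Real.exp ((h x + B i x) + ∑ j ∈ T, φ j x (x j)))
          ∂(Measure.pi fun _ : ι => ν) := by
          congr 1 with x; congr 2; ring
      _ ≤ ∫⁻ x, ENNReal.ofReal (Real.exp ((h x + B i x) + ∑ j ∈ T, B j x))
          ∂(Measure.pi fun _ : ι => ν) := by
          refine ih hTJ (fun x => h x + B i x) (hh.add (hB i)) fun j hj x u => ?_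
          rw [hhT j (Finset.mem_insert_of_mem hj), hBi i hiJ _ _ (hup j (hTJ hj) x u)]
      _ = _ := by
          congr 1 with x; congr 2; ring

/-- The moment generating function of a sum of independent variables, bounded factor by factor. -/
theorem lintegral_exp_sum_le_exp_sum {φ : ι → ℝ → ℝ} {b : ι → ℝ} (hφ : ∀ i, Measurable (φ i))
    (hle : ∀ i, ∫⁻ u, ENNReal.ofReal (Real.exp (φ i u)) ∂ν ≤ ENNReal.ofReal (Real.exp (b i))) :
    ∫⁻ x, ENNReal.ofReal (Real.exp (∑ i, φ i (x i))) ∂(Measure.pi fun _ : ι => ν) ≤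
      ENNReal.ofReal (Real.exp (∑ i, b i)) := by
  have := lintegral_exp_sum_le (ν := ν) Finset.univ (B := fun i _ => b i)
    (φ := fun i _ u => φ i u) (fun i => measurable_const)
    (fun i => (hφ i).comp (measurable_pi_apply i)) (fun _ _ _ _ _ => rfl)
    (fun _ _ _ _ _ _ => rfl) (fun i _ _ => hle i)
  simpa using this

namespace IsSubgaussianLaw

variable {K : ℝ}

theorem lintegral_exp_linear_le (hν : IsSubgaussianLaw K ν) (hK : 0 < K) (b : ι → ℝ) (s : ℝ) :
    ∫⁻ x, ENNReal.ofReal (Real.exp (s * ∑ i, b i * x i)) ∂(Measure.pi fun _ : ι => ν) ≤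
      ENNReal.ofReal (Real.exp (K * (∑ i, b i ^ 2) * s ^ 2)) := by
  have := lintegral_exp_sum_le_exp_sum (ν := ν) (φ := fun i u => s * b i * u)
    (b := fun i => K * (s * b i) ^ 2) (fun i => by fun_prop)
    (fun i => hν.lintegral_exp_mul_le hK _)
  convert this using 4 with x
  · rw [Finset.mul_sum]
    simp only [mul_assoc]
  · rw [mul_assoc, Finset.sum_mul, Finset.mul_sum]
    exact Finset.sum_congr rfl fun i _ => by ring

theorem lintegral_exp_sum_sq_le (hν : IsSubgaussianLaw K ν) {θ : ℝ} (h0 : 0 ≤ θ) (h1 : θ ≤ 1) :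
    ∫⁻ x, ENNReal.ofReal (Real.exp (θ / K * ∑ i, x i ^ 2)) ∂(Measure.pi fun _ : ι => ν) ≤
      ENNReal.ofReal (Real.exp (θ * Fintype.card ι)) := by
  have := lintegral_exp_sum_le_exp_sum (ι := ι) (ν := ν) (φ := fun i u => θ * (u ^ 2 / K))
    (b := fun i => θ) (fun i => by fun_prop) (fun i => hν.lintegral_exp_mul_sq_le h0 h1)
  convert this using 4 with x
  · rw [Finset.mul_sum]
    congr 1
    exact Finset.sum_congr rfl fun i _ => by ring
  · simp [mul_comm]

theorem lintegral_exp_diag_le (hν : IsSubgaussianLaw K ν) (hK : 0 < K) {q : ι → ℝ} {c : ℝ}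
    (hc : 0 < c) (hq : ∀ i, |q i| ≤ c) {s : ℝ} (hs : |s| ≤ 1 / (2 * K * c)) :
    ∫⁻ x, ENNReal.ofReal (Real.exp (s * ∑ i, q i * (x i ^ 2 - ∫ v, v ^ 2 ∂ν)))
        ∂(Measure.pi fun _ : ι => ν) ≤
      ENNReal.ofReal (Real.exp (48 * K ^ 2 * c ^ 2 * Fintype.card ι * s ^ 2)) := by
  have hsq : ∀ i, |s * q i| ≤ 1 / (2 * K) := fun i => by
    rw [abs_mul]
    calc |s| * |q i| ≤ 1 / (2 * K * c) * c := by gcongr; exact hq i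
      _ = _ := by field_simp
  refine (le_of_eq ?_).trans ((lintegral_exp_sum_le_exp_sum (ι := ι) (ν := ν)
    (φ := fun i u => s * q i * (u ^ 2 - ∫ v, v ^ 2 ∂ν))
    (b := fun i => 48 * K ^ 2 * (s * q i) ^ 2) (fun i => by fun_prop)
    (fun i => hν.lintegral_exp_mul_sq_sub_le hK (hsq i))).trans ?_)
  · congr with x
    rw [Finset.mul_sum]
    simp only [mul_assoc]
  · refine ENNReal.ofReal_le_ofReal (Real.exp_le_exp.2 ?_)
    calc ∑ i, 48 * K ^ 2 * (s * q i) ^ 2 ≤ ∑ _i : ι, 48 * K ^ 2 * (s * c) ^ 2 := by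
          refine Finset.sum_le_sum fun i _ => ?_
          rw [mul_pow, ← sq_abs (q i), mul_pow]
          gcongr
          exact hq i
      _ = _ := by simp; ring

end IsSubgaussianLaw

end ProductMeasure

/-! ### Quadratic forms in sub-Gaussian variables -/

section QuadraticForm

variable {ι : Type*} [Fintype ι] [DecidableEq ι]

theorem card_filter_mem_notMem {i j : ι} (hij : i ≠ j) :
    4 * (Finset.univ.filter fun I : Finset ι => i ∈ I ∧ j ∉ I).card = 2 ^ Fintype.card ι := by
  have h1 : (Finset.univ.filter fun I : Finset ι => i ∈ I ∧ j ∉ I) = Finset.Icc {i} {j}ᶜ := by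
    ext I
    simp [Finset.subset_compl_comm (s := I), Finset.subset_iff]
  have h2 : 2 ≤ Fintype.card ι := Fintype.one_lt_card_iff.2 ⟨i, j, hij⟩
  rw [h1, Finset.card_Icc_finset (by simpa using hij.symm), Finset.card_compl,
    Finset.card_singleton, Finset.card_singleton, show (4 : ℕ) = 2 ^ 2 by norm_num, ← pow_add]
  congr 1
  omega

/-- The decoupling identity: an off-diagonal quadratic form is the mean over all subsets `I` of
`4` times its part with row index in `I` and column index outside `I`. -/
theorem offDiag_eq_sum_subsets (Q : Matrix ι ι ℝ) (x : ι → ℝ) :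
    ∑ i, ∑ j ∈ Finset.univ.erase i, Q i j * x i * x j =
      ∑ I : Finset ι, ((1 : ℝ) / 2 ^ Fintype.card ι) *
        (4 * ∑ i ∈ I, x i * ∑ j ∈ Iᶜ, Q i j * x j) := by
  have h1 : ∀ I : Finset ι, ∑ i ∈ I, x i * ∑ j ∈ Iᶜ, Q i j * x j =
      ∑ i, ∑ j, if i ∈ I ∧ j ∉ I then Q i j * x i * x j else 0 := by
    intro I
    rw [← Finset.sum_subset (Finset.subset_univ I) fun i _ hi => by simp [hi]]
    refine Finset.sum_congr rfl fun i hi => ?_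
    simp only [hi, true_and, ← Finset.mem_compl, Finset.sum_ite_mem, Finset.univ_inter]
    rw [Finset.mul_sum]
    exact Finset.sum_congr rfl fun j _ => by ring
  simp only [h1, ← Finset.mul_sum]
  rw [Finset.sum_comm, Finset.mul_sum, Finset.mul_sum]
  refine Finset.sum_congr rfl fun i _ => ?_
  rw [Finset.sum_comm, Finset.mul_sum, Finset.mul_sum,
    ← Finset.add_sum_erase _ _ (Finset.mem_univ i)]
  simp only [and_not_self, if_false, Finset.sum_const_zero, mul_zero, zero_add]
  refine Finset.sum_congr rfl fun j hj => ?_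
  have h2 : (4 : ℝ) * (Finset.univ.filter fun I : Finset ι => i ∈ I ∧ j ∉ I).card =
      2 ^ Fintype.card ι := mod_cast card_filter_mem_notMem (Finset.ne_of_mem_erase hj).symm
  rw [← Finset.sum_filter, Finset.sum_const, nsmul_eq_mul, ← mul_assoc, ← mul_assoc, mul_assoc _ 4,
    h2]
  field_simp

theorem exp_offDiag_le (Q : Matrix ι ι ℝ) (x : ι → ℝ) (s : ℝ) :
    Real.exp (s * ∑ i, ∑ j ∈ Finset.univ.erase i, Q i j * x i * x j) ≤
      ∑ I : Finset ι, ((1 : ℝ) / 2 ^ Fintype.card ι) *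
        Real.exp (∑ i ∈ I, 4 * s * (∑ j ∈ Iᶜ, Q i j * x j) * x i) := by
  have h := convexOn_exp.map_sum_le (t := (Finset.univ : Finset (Finset ι)))
    (w := fun _ => (1 : ℝ) / 2 ^ Fintype.card ι)
    (p := fun I => ∑ i ∈ I, 4 * s * (∑ j ∈ Iᶜ, Q i j * x j) * x i)
    (fun _ _ => by positivity) (by simp) (fun _ _ => Set.mem_univ _)
  simp only [smul_eq_mul] at h
  refine le_trans (le_of_eq ?_) h
  rw [offDiag_eq_sum_subsets, Finset.mul_sum]
  congr 1
  refine Finset.sum_congr rfl fun I _ => ?_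
  rw [mul_left_comm, Finset.mul_sum, Finset.mul_sum]
  congr 1
  exact Finset.sum_congr rfl fun i _ => by ring

variable {K : ℝ} {ν : Measure ℝ} [IsProbabilityMeasure ν]

/-- The moment generating function of a decoupled bilinear form. Given the coordinates outside
`I`, it is a linear form in those in `I`, and the sub-Gaussian bound turns it into the square of
`Q` applied to a truncation of `x`, which is at most `c² ‖x‖²`. -/
theorem IsSubgaussianLaw.lintegral_exp_decoupled_le (hν : IsSubgaussianLaw K ν) (hK : 0 < K)
    {Q : Matrix ι ι ℝ} {c : ℝ} (hc : 0 < c)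
    (hQ : ∀ v : ι → ℝ, ∑ i, (∑ j, Q i j * v j) ^ 2 ≤ c ^ 2 * ∑ i, v i ^ 2)
    {s : ℝ} (hs : |s| ≤ 1 / (4 * K * c)) (I : Finset ι) :
    ∫⁻ x, ENNReal.ofReal (Real.exp (∑ i ∈ I, 4 * s * (∑ j ∈ Iᶜ, Q i j * x j) * x i))
        ∂(Measure.pi fun _ : ι => ν) ≤
      ENNReal.ofReal (Real.exp (48 * K ^ 2 * c ^ 2 * Fintype.card ι * s ^ 2)) := by
  have hs2 : 16 * K ^ 2 * c ^ 2 * s ^ 2 ≤ 1 := by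
    have h1 : 4 * K * c * |s| ≤ 1 := by
      calc 4 * K * c * |s| ≤ 4 * K * c * (1 / (4 * K * c)) := by gcongr
        _ = 1 := by field_simp
    have h2 : (4 * K * c * |s|) ^ 2 ≤ 1 := pow_le_one₀ (by positivity) h1
    rw [mul_pow, sq_abs] at h2
    linarith
  have hcongr : ∀ (x y : ι → ℝ), (∀ j ∉ I, x j = y j) → ∀ i,
      ∑ j ∈ Iᶜ, Q i j * x j = ∑ j ∈ Iᶜ, Q i j * y j := fun x y hxy i =>
    Finset.sum_congr rfl fun j hj => by rw [hxy j (Finset.mem_compl.1 hj)]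
  have h1 := lintegral_exp_sum_le (ν := ν) I
    (φ := fun i x u => 4 * s * (∑ j ∈ Iᶜ, Q i j * x j) * u)
    (B := fun i x => K * (4 * s * (∑ j ∈ Iᶜ, Q i j * x j)) ^ 2)
    (fun i => by fun_prop) (fun i => by fun_prop)
    (fun i _ x y hxy => by simp only [hcongr x y hxy i])
    (fun i _ x y hxy v => by simp only [hcongr x y hxy i])
    (fun i _ x => hν.lintegral_exp_mul_le hK _)
  refine h1.trans ?_
  have h2 := hν.lintegral_exp_sum_sq_le (ι := ι) (θ := 16 * K ^ 2 * c ^ 2 * s ^ 2)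
    (by positivity) hs2
  refine le_trans (lintegral_mono fun x => ENNReal.ofReal_le_ofReal (Real.exp_le_exp.2 ?_))
    (h2.trans (ENNReal.ofReal_le_ofReal (Real.exp_le_exp.2 ?_)))
  · -- Apply the bound on `Q` to `x` restricted to the complement of `I`.
    have h3 := hQ fun j => if j ∈ Iᶜ then x j else 0
    simp only [mul_ite, mul_zero, ite_pow, ne_eq, OfNat.ofNat_ne_zero, not_false_eq_true,
      zero_pow, Finset.sum_ite_mem, Finset.univ_inter] at h3
    calc ∑ i ∈ I, K * (4 * s * ∑ j ∈ Iᶜ, Q i j * x j) ^ 2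
        = 16 * K * s ^ 2 * ∑ i ∈ I, (∑ j ∈ Iᶜ, Q i j * x j) ^ 2 := by
          rw [Finset.mul_sum]
          exact Finset.sum_congr rfl fun i _ => by ring
      _ ≤ 16 * K * s ^ 2 * ∑ i, (∑ j ∈ Iᶜ, Q i j * x j) ^ 2 := by
          gcongr
          exact Finset.subset_univ I
      _ ≤ 16 * K * s ^ 2 * (c ^ 2 * ∑ i ∈ Iᶜ, x i ^ 2) := by gcongr
      _ ≤ 16 * K * s ^ 2 * (c ^ 2 * ∑ i, x i ^ 2) := by
          gcongr
          exact Finset.subset_univ _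
      _ = _ := by field_simp
  · have : 0 ≤ K ^ 2 * c ^ 2 * s ^ 2 * Fintype.card ι := by positivity
    linarith

theorem IsSubgaussianLaw.lintegral_exp_offDiag_le (hν : IsSubgaussianLaw K ν) (hK : 0 < K)
    {Q : Matrix ι ι ℝ} {c : ℝ} (hc : 0 < c)
    (hQ : ∀ v : ι → ℝ, ∑ i, (∑ j, Q i j * v j) ^ 2 ≤ c ^ 2 * ∑ i, v i ^ 2)
    {s : ℝ} (hs : |s| ≤ 1 / (4 * K * c)) :
    ∫⁻ x, ENNReal.ofReal
        (Real.exp (s * ∑ i, ∑ j ∈ Finset.univ.erase i, Q i j * x i * x j))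
        ∂(Measure.pi fun _ : ι => ν) ≤
      ENNReal.ofReal (Real.exp (48 * K ^ 2 * c ^ 2 * Fintype.card ι * s ^ 2)) := by
  set b := ENNReal.ofReal (Real.exp (48 * K ^ 2 * c ^ 2 * Fintype.card ι * s ^ 2))
  calc _ ≤ ∫⁻ x, ∑ I : Finset ι, ENNReal.ofReal ((1 : ℝ) / 2 ^ Fintype.card ι) *
        ENNReal.ofReal (Real.exp (∑ i ∈ I, 4 * s * (∑ j ∈ Iᶜ, Q i j * x j) * x i))
        ∂(Measure.pi fun _ : ι => ν) := by
        refine lintegral_mono fun x => ?_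
        simp only [← ENNReal.ofReal_mul (show (0 : ℝ) ≤ 1 / 2 ^ Fintype.card ι by positivity)]
        rw [← ENNReal.ofReal_sum_of_nonneg fun I _ => by positivity]
        exact ENNReal.ofReal_le_ofReal (exp_offDiag_le Q x s)
    _ = ∑ I : Finset ι, ENNReal.ofReal ((1 : ℝ) / 2 ^ Fintype.card ι) *
        ∫⁻ x, ENNReal.ofReal (Real.exp (∑ i ∈ I, 4 * s * (∑ j ∈ Iᶜ, Q i j * x j) * x i))
        ∂(Measure.pi fun _ : ι => ν) := by
        rw [lintegral_finsetSum _ fun I _ => by fun_prop]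
        refine Finset.sum_congr rfl fun I _ => ?_
        rw [lintegral_const_mul _ (by fun_prop)]
    _ ≤ ∑ I : Finset ι, ENNReal.ofReal ((1 : ℝ) / 2 ^ Fintype.card ι) * b := by
        gcongr with I
        exact hν.lintegral_exp_decoupled_le hK hc hQ hs I
    _ = b := by
        rw [← Finset.sum_mul, ← ENNReal.ofReal_sum_of_nonneg fun I _ => by positivity]
        simp

end QuadraticForm

section Chernoff

theorem measureReal_le_le_of_lintegral_exp {α : Type*} [MeasurableSpace α] {π : Measure α}
    [IsProbabilityMeasure π] {S : α → ℝ} (hS : Measurable S) {s u r : ℝ} (hs : 0 ≤ s)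
    (h : ∫⁻ x, ENNReal.ofReal (Real.exp (s * S x)) ∂π ≤ ENNReal.ofReal (Real.exp r)) :
    π.real {x | u ≤ S x} ≤ Real.exp (r - s * u) := by
  refine ENNReal.toReal_le_of_le_ofReal (Real.exp_nonneg _) ?_
  have h1 : π {x | u ≤ S x} ≤
      ∫⁻ x, ENNReal.ofReal (Real.exp (-(s * u))) * ENNReal.ofReal (Real.exp (s * S x)) ∂π := by
    rw [← lintegral_indicator_one (measurableSet_le measurable_const hS)]
    refine lintegral_mono fun x => ?_
    rw [← ENNReal.ofReal_mul (Real.exp_nonneg _), ← Real.exp_add]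
    by_cases hx : x ∈ {x | u ≤ S x}
    swap
    · simp [Set.indicator_of_notMem hx]
    rw [Set.indicator_of_mem hx]
    simp only [Pi.one_apply, ENNReal.one_le_ofReal]
    refine Real.one_le_exp ?_
    have := mul_le_mul_of_nonneg_left (show u ≤ S x from hx) hs
    linarith
  refine h1.trans ?_
  rw [lintegral_const_mul _ (by fun_prop), show r - s * u = -(s * u) + r by ring, Real.exp_add,
    ENNReal.ofReal_mul (Real.exp_nonneg _)]
  gcongr

/-- The two-sided Chernoff bound, for a fixed `s`. -/
theorem measureReal_le_abs_le_of_lintegral_exp {α : Type*} [MeasurableSpace α] {π : Measure α}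
    [IsProbabilityMeasure π] {S : α → ℝ} (hS : Measurable S) {s u r : ℝ} (hs : 0 ≤ s)
    (h : ∫⁻ x, ENNReal.ofReal (Real.exp (s * S x)) ∂π ≤ ENNReal.ofReal (Real.exp r))
    (h' : ∫⁻ x, ENNReal.ofReal (Real.exp (-s * S x)) ∂π ≤ ENNReal.ofReal (Real.exp r)) :
    π.real {x | u ≤ |S x|} ≤ 2 * Real.exp (r - s * u) := by
  have h1 := measureReal_le_le_of_lintegral_exp (u := u) hS hs h
  have h2 := measureReal_le_le_of_lintegral_exp (u := u) (S := fun x => -S x) hS.neg hs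
    (by simpa using h')
  calc π.real {x | u ≤ |S x|} ≤ π.real ({x | u ≤ S x} ∪ {x | u ≤ -S x}) :=
        measureReal_mono fun x (hx : u ≤ |S x|) => le_abs.1 hx
    _ ≤ _ := measureReal_union_le _ _
    _ ≤ _ := by linarith

/-- The optimised Chernoff bound for a variable with a sub-exponential moment generating
function. -/
theorem measureReal_le_abs_le_of_subexponential {α : Type*} [MeasurableSpace α] {π : Measure α}
    [IsProbabilityMeasure π] {S : α → ℝ} (hS : Measurable S) {a b n u : ℝ} (ha : 0 < a)
    (hb : 0 < b) (hn : 0 ≤ n) (hu : 0 ≤ u)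
    (h : ∀ s, |s| ≤ b → ∫⁻ x, ENNReal.ofReal (Real.exp (s * S x)) ∂π ≤
      ENNReal.ofReal (Real.exp (a * n * s ^ 2))) :
    π.real {x | n * u ≤ |S x|} ≤
      2 * Real.exp (-(n * min (u ^ 2 / (4 * a)) (b * u / 2))) := by
  -- The minimiser of `a s² - s u` over `s ≤ b`.
  set s := min (u / (2 * a)) b with hsdef
  have hs0 : 0 ≤ s := le_min (by positivity) hb.le
  have hsb : |s| ≤ b := by rw [abs_of_nonneg hs0]; exact min_le_right _ _
  have h1 := measureReal_le_abs_le_of_lintegral_exp (u := n * u) hS hs0 (h s hsb)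
    (by simpa using h (-s) (by rwa [abs_neg]))
  refine h1.trans ?_
  gcongr
  have h2 : min (u ^ 2 / (4 * a)) (b * u / 2) ≤ s * u - a * s ^ 2 := by
    rcases le_total (u / (2 * a)) b with hle | hle
    · rw [hsdef, min_eq_left hle]
      refine (min_le_left _ _).trans (le_of_eq ?_)
      field_simp
      ring
    · rw [hsdef, min_eq_right hle]
      refine (min_le_right _ _).trans ?_
      rw [le_div_iff₀ (by positivity)] at hle
      nlinarith
  nlinarith

end Chernoff

section HansonWright

variable {ι : Type*} [Fintype ι] {K : ℝ} {ν : Measure ℝ} [IsProbabilityMeasure ν]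

/-- A Hanson-Wright inequality: the quadratic form of a matrix with operator norm at most `c`
concentrates around its mean, which is the variance times the trace. -/
theorem IsSubgaussianLaw.measureReal_quadraticForm_le [DecidableEq ι]
    (hν : IsSubgaussianLaw K ν)
    (hK : 0 < K) {Q : Matrix ι ι ℝ} {c : ℝ} (hc : 0 < c)
    (hQ : ∀ v : ι → ℝ, ∑ i, (∑ j, Q i j * v j) ^ 2 ≤ c ^ 2 * ∑ i, v i ^ 2) {u : ℝ} (hu : 0 ≤ u) :
    (Measure.pi fun _ : ι => ν).real {x | Fintype.card ι * (2 * u) ≤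
        |∑ i, ∑ j, Q i j * x i * x j - (∫ v, v ^ 2 ∂ν) * ∑ i, Q i i|} ≤
      4 * Real.exp (-(Fintype.card ι *
        min (u ^ 2 / (4 * (48 * K ^ 2 * c ^ 2))) (1 / (4 * K * c) * u / 2))) := by
  set σ := ∫ v, v ^ 2 ∂ν
  have hdiag : ∀ i, |Q i i| ≤ c := by
    intro i
    -- The `i`-th column of `Q` is its value at a unit vector.
    have h1 := hQ (Pi.single i 1)
    simp only [Pi.single_apply, mul_ite, mul_one, mul_zero, Finset.sum_ite_eq', Finset.mem_univ,
      if_true, ite_pow, one_pow, ne_eq, OfNat.ofNat_ne_zero, not_false_eq_true, zero_pow] at h1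
    have h2 := Finset.single_le_sum (f := fun l => Q l i ^ 2) (fun l _ => sq_nonneg _)
      (Finset.mem_univ i)
    exact abs_le_of_sq_le_sq (h2.trans h1) hc.le
  have h1 := measureReal_le_abs_le_of_subexponential (π := Measure.pi fun _ : ι => ν)
    (S := fun x => ∑ i, Q i i * (x i ^ 2 - σ)) (a := 48 * K ^ 2 * c ^ 2)
    (b := 1 / (4 * K * c)) (n := Fintype.card ι) (u := u) (by fun_prop) (by positivity)
    (by positivity) (by positivity) hu
    (fun s hs => hν.lintegral_exp_diag_le hK hc hdiag (hs.trans (by gcongr; norm_num)))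
  have h2 := measureReal_le_abs_le_of_subexponential (π := Measure.pi fun _ : ι => ν)
    (S := fun x => ∑ i, ∑ j ∈ Finset.univ.erase i, Q i j * x i * x j) (a := 48 * K ^ 2 * c ^ 2)
    (b := 1 / (4 * K * c)) (n := Fintype.card ι) (u := u) (by fun_prop) (by positivity)
    (by positivity) (by positivity) hu
    (fun s hs => hν.lintegral_exp_offDiag_le hK hc hQ hs)
  refine (measureReal_mono (fun x hx => ?_)).trans ((measureReal_union_le _ _).trans
    ((add_le_add h1 h2).trans (le_of_eq (by ring))))
  have hsplit : ∑ i, ∑ j, Q i j * x i * x j - σ * ∑ i, Q i i =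
      ∑ i, Q i i * (x i ^ 2 - σ) + ∑ i, ∑ j ∈ Finset.univ.erase i, Q i j * x i * x j := by
    rw [Finset.mul_sum, ← Finset.sum_sub_distrib, ← Finset.sum_add_distrib]
    refine Finset.sum_congr rfl fun i _ => ?_
    rw [← Finset.add_sum_erase _ _ (Finset.mem_univ i)]
    ring
  simp only [Set.mem_ofPred_eq, hsplit] at hx
  simp only [Set.mem_union, Set.mem_ofPred_eq]
  by_contra! hcon
  have := abs_add_le (∑ i, Q i i * (x i ^ 2 - σ))
    (∑ i, ∑ j ∈ Finset.univ.erase i, Q i j * x i * x j)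
  linarith [hcon.1, hcon.2]

/-- Concentration of a linear form whose coefficient vector has squared norm at most `b`. -/
theorem IsSubgaussianLaw.measureReal_linear_le (hν : IsSubgaussianLaw K ν) (hK : 0 < K)
    {β : ι → ℝ} {b u : ℝ} (hb : 0 < b) (hβ : ∑ i, β i ^ 2 ≤ b) (hu : 0 ≤ u) :
    (Measure.pi fun _ : ι => ν).real {x | u ≤ |∑ i, β i * x i|} ≤
      2 * Real.exp (-(u ^ 2 / (4 * K * b))) := by
  have h : ∀ s : ℝ, ∫⁻ x, ENNReal.ofReal (Real.exp (s * ∑ i, β i * x i))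
      ∂(Measure.pi fun _ : ι => ν) ≤ ENNReal.ofReal (Real.exp (K * b * s ^ 2)) := fun s =>
    (hν.lintegral_exp_linear_le hK β s).trans (by gcongr)
  refine (measureReal_le_abs_le_of_lintegral_exp (s := u / (2 * K * b))
    (r := K * b * (u / (2 * K * b)) ^ 2) (by fun_prop) (by positivity) (h _)
    (by simpa using h (-(u / (2 * K * b))))).trans (le_of_eq ?_)
  congr 2
  field_simp
  ring

end HansonWright

/-! ### Linear smoothers -/

section Smoother

variable {ι : Type*} [Fintype ι]

/-- Schur's test. -/
theorem sum_sq_sum_mul_le {κ : Type*} [Fintype κ] {W : ι → κ → ℝ} {r c : ℝ}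
    (h0 : ∀ i j, 0 ≤ W i j) (hr : ∀ i, ∑ j, W i j ≤ r) (hc : ∀ j, ∑ i, W i j ≤ c) (hr0 : 0 ≤ r)
    (v : κ → ℝ) : ∑ i, (∑ j, W i j * v j) ^ 2 ≤ r * c * ∑ j, v j ^ 2 :=
  calc ∑ i, (∑ j, W i j * v j) ^ 2 ≤ ∑ i, r * ∑ j, W i j * v j ^ 2 := by
        refine Finset.sum_le_sum fun i _ => ?_
        have h1 := Finset.sum_sq_le_sum_mul_sum_of_sq_le_mul Finset.univ
          (r := fun j => W i j * v j) (f := fun j => W i j) (g := fun j => W i j * v j ^ 2)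
          (fun j _ => h0 i j) (fun j _ => mul_nonneg (h0 i j) (sq_nonneg _))
          (fun j _ => le_of_eq (by ring))
        exact h1.trans (mul_le_mul_of_nonneg_right (hr i)
          (Finset.sum_nonneg fun j _ => mul_nonneg (h0 i j) (sq_nonneg _)))
    _ = r * ∑ j, (∑ i, W i j) * v j ^ 2 := by
        rw [← Finset.mul_sum, Finset.sum_comm]
        simp only [Finset.sum_mul]
    _ ≤ r * ∑ j, c * v j ^ 2 := by
        gcongr with j _
        exact hc j
    _ = r * c * ∑ j, v j ^ 2 := by rw [← Finset.mul_sum, mul_assoc]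

/-- A smoothing matrix: nonnegative weights, no weight on the diagonal (an observation does not
predict itself), row sums at most `1` and column sums at most `c`. -/
structure IsSmoother (c : ℝ) (W : ι → ι → ℝ) : Prop where
  nonneg : ∀ i j, 0 ≤ W i j
  diag : ∀ i, W i i = 0
  row_le : ∀ i, ∑ j, W i j ≤ 1
  col_le : ∀ j, ∑ i, W i j ≤ c
  one_le : 1 ≤ c

/-- The matrix `Wᵀ W - 2 W`, whose quadratic form is `‖(1 - W) e‖² - ‖e‖²`. -/
def residualForm (W : ι → ι → ℝ) : Matrix ι ι ℝ :=
  fun i j => ∑ l, W l i * W l j - 2 * W i j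

/-- The vector `(1 - W)ᵀ (1 - W) μ`, which pairs the signal with the noise. -/
def residualCross (W : ι → ι → ℝ) (mu : ι → ℝ) (j : ι) : ℝ :=
  (mu j - ∑ l, W j l * mu l) - ∑ i, W i j * (mu i - ∑ l, W i l * mu l)

theorem sum_residualForm_mul (W : ι → ι → ℝ) (e : ι → ℝ) :
    ∑ i, ∑ j, residualForm W i j * e i * e j =
      ∑ i, ((∑ j, W i j * e j) ^ 2 - 2 * e i * ∑ j, W i j * e j) := by
  have h1 : ∑ i, ∑ j, residualForm W i j * e i * e j =
      ∑ i, ∑ j, ∑ l, (W l i * e i) * (W l j * e j) -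
        ∑ i, ∑ j, 2 * e i * (W i j * e j) := by
    rw [← Finset.sum_sub_distrib]
    refine Finset.sum_congr rfl fun i _ => ?_
    rw [← Finset.sum_sub_distrib]
    refine Finset.sum_congr rfl fun j _ => ?_
    rw [residualForm, sub_mul, sub_mul, Finset.sum_mul, Finset.sum_mul]
    congr 1
    · exact Finset.sum_congr rfl fun l _ => by ring
    · ring
  rw [h1, Finset.sum_sub_distrib]
  congr 1
  · simp only [sq, Finset.sum_mul_sum]
    exact (Finset.sum_congr rfl fun i _ => Finset.sum_comm).trans Finset.sum_comm
  · simp only [Finset.mul_sum]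

/-- The residual sum of squares of the data `mu + e`: up to a term that does not depend on `W`,
it is the bias plus a linear and a quadratic form in the noise. -/
theorem sum_residual_sq_eq (W : ι → ι → ℝ) (mu e : ι → ℝ) :
    ∑ i, (mu i + e i - ∑ j, W i j * (mu j + e j)) ^ 2 =
      ∑ i, (mu i - ∑ j, W i j * mu j) ^ 2 + ∑ i, e i ^ 2 +
        2 * ∑ j, residualCross W mu j * e j + ∑ i, ∑ j, residualForm W i j * e i * e j := by
  have hcross : ∑ j, residualCross W mu j * e j =
      ∑ i, (mu i - ∑ j, W i j * mu j) * (e i - ∑ j, W i j * e j) := by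
    simp only [residualCross]
    generalize hR : (fun i => mu i - ∑ l, W i l * mu l) = R
    simp only [show ∀ i, mu i - ∑ l, W i l * mu l = R i from fun i => congrFun hR i]
    simp only [sub_mul, mul_sub, Finset.sum_sub_distrib, Finset.sum_mul, Finset.mul_sum]
    rw [Finset.sum_comm]
    congr 1
    exact Finset.sum_congr rfl fun _ _ => Finset.sum_congr rfl fun _ _ => by ring
  rw [hcross, sum_residualForm_mul, Finset.mul_sum, ← Finset.sum_add_distrib,
    ← Finset.sum_add_distrib, ← Finset.sum_add_distrib]
  refine Finset.sum_congr rfl fun i _ => ?_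
  simp only [mul_add, Finset.sum_add_distrib]
  ring

namespace IsSmoother

variable {c : ℝ} {W : ι → ι → ℝ}

theorem sum_sq_apply_le (hW : IsSmoother c W) (v : ι → ℝ) :
    ∑ i, (∑ j, W i j * v j) ^ 2 ≤ c * ∑ j, v j ^ 2 := by
  simpa using sum_sq_sum_mul_le hW.nonneg hW.row_le hW.col_le zero_le_one v

theorem sum_sq_transpose_le (hW : IsSmoother c W) (v : ι → ℝ) :
    ∑ j, (∑ i, W i j * v i) ^ 2 ≤ c * ∑ i, v i ^ 2 := by
  simpa using sum_sq_sum_mul_le (W := fun j i => W i j) (fun i j => hW.nonneg j i) hW.col_le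
    hW.row_le (zero_le_one.trans hW.one_le) v

theorem _root_.sum_sub_sq_le (u v : ι → ℝ) :
    ∑ i, (u i - v i) ^ 2 ≤ 2 * ∑ i, u i ^ 2 + 2 * ∑ i, v i ^ 2 := by
  rw [Finset.mul_sum, Finset.mul_sum, ← Finset.sum_add_distrib]
  exact Finset.sum_le_sum fun i _ => by nlinarith [sq_nonneg (u i + v i)]

theorem sum_residualForm_sq_le (hW : IsSmoother c W) (v : ι → ℝ) :
    ∑ i, (∑ j, residualForm W i j * v j) ^ 2 ≤ (4 * c) ^ 2 * ∑ i, v i ^ 2 := by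
  have h1 : ∀ i, ∑ j, residualForm W i j * v j =
      (∑ l, W l i * ∑ j, W l j * v j) - 2 * ∑ j, W i j * v j := by
    intro i
    simp only [residualForm, sub_mul, Finset.sum_sub_distrib, Finset.mul_sum, Finset.sum_mul]
    rw [Finset.sum_comm]
    congr 1
    · exact Finset.sum_congr rfl fun _ _ => Finset.sum_congr rfl fun _ _ => by ring
    · exact Finset.sum_congr rfl fun _ _ => by ring
  simp only [h1]
  have h2 := sum_sub_sq_le (fun i => ∑ l, W l i * ∑ j, W l j * v j)
    (fun i => 2 * ∑ j, W i j * v j)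
  have h3 := hW.sum_sq_transpose_le fun l => ∑ j, W l j * v j
  have h4 := hW.sum_sq_apply_le v
  simp only [mul_pow, ← Finset.mul_sum] at h2
  have hv : 0 ≤ ∑ i, v i ^ 2 := Finset.sum_nonneg fun i _ => sq_nonneg _
  have h5 : c * ∑ i, (∑ j, W i j * v j) ^ 2 ≤ c * (c * ∑ i, v i ^ 2) :=
    mul_le_mul_of_nonneg_left h4 (zero_le_one.trans hW.one_le)
  have h6 : c * ∑ i, v i ^ 2 ≤ c ^ 2 * ∑ i, v i ^ 2 := by
    gcongr
    nlinarith [hW.one_le]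
  nlinarith

theorem sum_residualCross_sq_le (hW : IsSmoother c W) (mu : ι → ℝ) :
    ∑ j, residualCross W mu j ^ 2 ≤ 16 * c ^ 2 * ∑ i, mu i ^ 2 := by
  have hv : 0 ≤ ∑ i, mu i ^ 2 := Finset.sum_nonneg fun i _ => sq_nonneg _
  have h1 := sum_sub_sq_le mu (fun i => ∑ j, W i j * mu j)
  have h2 := hW.sum_sq_apply_le mu
  have h3 := sum_sub_sq_le (fun i => mu i - ∑ j, W i j * mu j)
    (fun j => ∑ i, W i j * (mu i - ∑ l, W i l * mu l))
  have h4 := hW.sum_sq_transpose_le (fun i => mu i - ∑ j, W i j * mu j)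
  have hc := hW.one_le
  have h5 : ∑ i, mu i ^ 2 ≤ c * ∑ i, mu i ^ 2 := le_mul_of_one_le_left hv hc
  set R := ∑ i, (mu i - ∑ j, W i j * mu j) ^ 2
  have hR : R ≤ 4 * (c * ∑ i, mu i ^ 2) := by linarith
  have hR0 : 0 ≤ R := Finset.sum_nonneg fun i _ => sq_nonneg _
  calc _ ≤ 2 * R + 2 * (c * R) := by unfold residualCross; linarith
    _ ≤ 4 * (c * R) := by nlinarith
    _ ≤ 4 * (c * (4 * (c * ∑ i, mu i ^ 2))) := by gcongr
    _ = _ := by ring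

variable {K : ℝ} {ν : Measure ℝ} [IsProbabilityMeasure ν]

theorem _root_.IsSubgaussianLaw.integral_sub_sum_sq (hν : IsSubgaussianLaw K ν) (hK : 0 < K)
    (a : ℝ) (w : ι → ℝ) :
    Integrable (fun e => (a - ∑ j, w j * e j) ^ 2) (Measure.pi fun _ : ι => ν) ∧
    ∫ e, (a - ∑ j, w j * e j) ^ 2 ∂(Measure.pi fun _ : ι => ν) =
      a ^ 2 + (∫ v, v ^ 2 ∂ν) * ∑ j, w j ^ 2 := by
  have hj : ∀ j, MemLp (fun e : ι → ℝ => w j * e j) 2 (Measure.pi fun _ : ι => ν) := fun j =>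
    ((hν.memLp_two hK).comp_measurePreserving (measurePreserving_eval _ j)).const_mul (w j)
  have hS : MemLp (fun e : ι → ℝ => ∑ j, w j * e j) 2 (Measure.pi fun _ : ι => ν) :=
    memLp_finsetSum _ fun j _ => hj j
  have hX : MemLp (fun e : ι → ℝ => a - ∑ j, w j * e j) 2 (Measure.pi fun _ : ι => ν) :=
    (memLp_const a).sub hS
  refine ⟨hX.integrable_sq, ?_⟩
  have hmean : ∫ e : ι → ℝ, ∑ j, w j * e j ∂(Measure.pi fun _ : ι => ν) = 0 := by
    rw [integral_finsetSum _ fun j _ => (hj j).integrable (by norm_num)]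
    refine Finset.sum_eq_zero fun j _ => ?_
    rw [integral_const_mul, integral_comp_eval (X := fun _ => ℝ) (μ := fun _ => ν) (i := j)
      (f := fun u : ℝ => u) (by fun_prop), hν.mean_zero, mul_zero]
  have hvar : Var[fun e : ι → ℝ => ∑ j, w j * e j; Measure.pi fun _ : ι => ν] =
      (∫ v, v ^ 2 ∂ν) * ∑ j, w j ^ 2 := by
    have h1 := variance_sum_pi (μ := fun _ : ι => ν) (X := fun j u => w j * u)
      fun j => (hν.memLp_two hK).const_mul (w j)
    have h2 : Var[fun u : ℝ => u; ν] = ∫ v, v ^ 2 ∂ν :=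
      variance_of_integral_eq_zero (by fun_prop) hν.mean_zero
    rw [Finset.mul_sum]
    convert h1 using 1
    · congr 1
      ext e
      simp
    · exact Finset.sum_congr rfl fun j _ => by rw [variance_const_mul, h2, mul_comm]
  have h3 := variance_eq_sub hX
  rw [variance_const_sub hS.aestronglyMeasurable, hvar,
    integral_sub (integrable_const a) (hS.integrable (by norm_num)), hmean] at h3
  simp at h3
  linarith

/-- The mean squared error of a linear smoother: squared bias plus variance. -/
theorem integral_sum_sub_sq (hW : IsSmoother c W) (hν : IsSubgaussianLaw K ν) (hK : 0 < K)
    (mu : ι → ℝ) :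
    ∫ e, ∑ i, (mu i - ∑ j, W i j * (mu j + e j)) ^ 2 ∂(Measure.pi fun _ : ι => ν) =
      ∑ i, (mu i - ∑ j, W i j * mu j) ^ 2 + (∫ v, v ^ 2 ∂ν) * ∑ i, residualForm W i i := by
  have h1 : ∀ (e : ι → ℝ) i, mu i - ∑ j, W i j * (mu j + e j) =
      (mu i - ∑ j, W i j * mu j) - ∑ j, W i j * e j := by
    intro e i
    simp only [mul_add, Finset.sum_add_distrib]
    ring
  simp only [h1]
  rw [integral_finsetSum _ fun i _ => (hν.integral_sub_sum_sq hK _ _).1]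
  simp only [(hν.integral_sub_sum_sq hK _ _).2, Finset.sum_add_distrib, ← Finset.mul_sum]
  rw [Finset.sum_comm (f := fun i j => W i j ^ 2)]
  simp [residualForm, hW.diag, sq]

/-- The residual sum of squares, less `‖e‖²`, deviates from the mean squared error by a centred
quadratic form, controlled by the Hanson-Wright inequality, and a linear form. -/
theorem measureReal_residual_sub_integral_le (hW : IsSmoother c W)
    (hν : IsSubgaussianLaw K ν) (hK : 0 < K) (mu : ι → ℝ) {u r : ℝ} (hu : 0 ≤ u)
    (hr : (Measure.pi fun _ : ι => ν).real
      {e | Fintype.card ι * u ≤ |∑ j, residualCross W mu j * e j|} ≤ r) :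
    (Measure.pi fun _ : ι => ν).real {e | Fintype.card ι * (4 * u) ≤
      |∑ i, (mu i + e i - ∑ j, W i j * (mu j + e j)) ^ 2 - ∑ i, e i ^ 2 -
        ∫ e, ∑ i, (mu i - ∑ j, W i j * (mu j + e j)) ^ 2 ∂(Measure.pi fun _ : ι => ν)|} ≤
      4 * Real.exp (-(Fintype.card ι *
        min (u ^ 2 / (4 * (48 * K ^ 2 * (4 * c) ^ 2))) (1 / (4 * K * (4 * c)) * u / 2))) + r := by
  classical
  have hc : 0 < 4 * c := by linarith [hW.one_le]
  have h1 := hν.measureReal_quadraticForm_le hK hc hW.sum_residualForm_sq_le hu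
  refine (measureReal_mono (fun e he => ?_)).trans ((measureReal_union_le _ _).trans
    (add_le_add h1 hr))
  simp only [Set.mem_ofPred_eq, hW.integral_sum_sub_sq hν hK, sum_residual_sq_eq] at he
  simp only [Set.mem_union, Set.mem_ofPred_eq]
  by_contra! hcon
  have h3 := abs_add_le (2 * ∑ j, residualCross W mu j * e j)
    (∑ i, ∑ j, residualForm W i j * e i * e j - (∫ v, v ^ 2 ∂ν) * ∑ i, residualForm W i i)
  rw [abs_mul, abs_two] at h3
  have h4 := he.trans (le_of_eq_of_le (congrArg abs (by ring)) h3)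
  linarith [hcon.1, hcon.2]

end IsSmoother

end Smoother

/-! ### How often a point is a near neighbour -/

section Cones

theorem norm_sub_lt_of_norm_normalize_sub_lt {E : Type*} [NormedAddCommGroup E] [NormedSpace ℝ E]
    {a b : E} (hb : b ≠ 0) (hab : ‖b‖ ≤ ‖a‖) (h : ‖‖a‖⁻¹ • a - ‖b‖⁻¹ • b‖ < 1) :
    ‖a - b‖ < ‖a‖ := by
  have hb0 : 0 < ‖b‖ := norm_pos_iff.2 hb
  have ha0 : 0 < ‖a‖ := hb0.trans_le hab
  have h1 : a - b = (‖a‖ - ‖b‖) • (‖a‖⁻¹ • a) + ‖b‖ • (‖a‖⁻¹ • a - ‖b‖⁻¹ • b) := by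
    rw [smul_sub, smul_inv_smul₀ hb0.ne', sub_smul, smul_inv_smul₀ ha0.ne']
    abel
  have h2 : ‖‖a‖⁻¹ • a‖ = 1 := by
    rw [norm_smul, norm_inv, norm_norm, inv_mul_cancel₀ ha0.ne']
  calc ‖a - b‖ ≤ ‖(‖a‖ - ‖b‖) • (‖a‖⁻¹ • a)‖ + ‖‖b‖ • (‖a‖⁻¹ • a - ‖b‖⁻¹ • b)‖ := by
        conv_lhs => rw [h1]
        exact norm_add_le _ _
    _ = (‖a‖ - ‖b‖) + ‖b‖ * ‖‖a‖⁻¹ • a - ‖b‖⁻¹ • b‖ := by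
        rw [norm_smul (‖a‖ - ‖b‖), norm_smul ‖b‖, h2, Real.norm_of_nonneg (sub_nonneg.2 hab),
          norm_norm, mul_one]
    _ < (‖a‖ - ‖b‖) + ‖b‖ * 1 := by gcongr
    _ = ‖a‖ := by ring

variable {d n k : ℕ} {x : Fin n → EuclideanSpace ℝ (Fin d)} {N : Fin n → Finset (Fin n)}

/-- If a set `S` of points that have `j` as a neighbour contains a point with all the other
points of `S` among its neighbours, then `S` has at most `k` elements: replace that point by `j`
to obtain a subset of its neighbourhood. -/
theorem IsNeighborSystem.card_le (h : IsNeighborSystem x k N) {j : Fin n} {S : Finset (Fin n)}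
    (hS : ∀ i ∈ S, j ∈ N i) (hmax : S.Nonempty → ∃ i ∈ S, ∀ l ∈ S, l ≠ i → l ∈ N i) :
    S.card ≤ k := by
  rcases S.eq_empty_or_nonempty with rfl | hne
  · simp
  obtain ⟨i, hi, hl⟩ := hmax hne
  have hj : j ∉ S.erase i := fun hj => h.notMem_self j (hS j (Finset.mem_of_mem_erase hj))
  calc S.card = (insert j (S.erase i)).card := by
        rw [Finset.card_insert_of_notMem hj, Finset.card_erase_add_one hi]
    _ ≤ (N i).card := by
        refine Finset.card_le_card (Finset.insert_subset (hS i hi) fun l hlS => ?_)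
        exact hl l (Finset.mem_of_mem_erase hlS) (Finset.ne_of_mem_erase hlS)
    _ = k := h.card_eq i

/-- A point is among the `k` nearest neighbours of at most `c k` points, with `c` depending only
on the dimension. Space is covered by `c - 2` narrow cones with apex `x j`: if `j` is a neighbour
of the point of a cone that is farthest from `x j`, then so are all the other points of the cone,
being closer to it. The points that coincide with `x j` are treated in the same manner,
the labels replacing the positions and the two half-lines replacing the cones. -/
theorem exists_card_filter_mem_neighbors_le (d : ℕ) : ∃ c : ℕ, 1 ≤ c ∧
    ∀ (n k : ℕ) (x : Fin n → EuclideanSpace ℝ (Fin d)) (N : Fin n → Finset (Fin n)),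
      IsNeighborSystem x k N → ∀ j, (Finset.univ.filter fun i => j ∈ N i).card ≤ c * k := by
  classical
  obtain ⟨T, -, hTfin, hT⟩ :=
    (isCompact_sphere (0 : EuclideanSpace ℝ (Fin d)) 1).finite_cover_balls
      (show (0 : ℝ) < 1 / 2 by norm_num)
  lift T to Finset (EuclideanSpace ℝ (Fin d)) using hTfin
  refine ⟨T.card + 2, by omega, fun n k x N h j => ?_⟩
  obtain ⟨z, hz, htie⟩ := h.tie
  let below := Finset.univ.filter fun i => j ∈ N i ∧ x i = x j ∧ z i < z j
  let above := Finset.univ.filter fun i => j ∈ N i ∧ x i = x j ∧ z j < z i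
  let cone := fun u => Finset.univ.filter fun i =>
    j ∈ N i ∧ x i ≠ x j ∧ ‖x i - x j‖⁻¹ • (x i - x j) ∈ Metric.ball u (1 / 2)
  have hmem : ∀ i, j ∈ N i → i ≠ j := fun i hi hij => h.notMem_self j (by rwa [hij] at hi)
  have hbelow : below.card ≤ k := by
    refine h.card_le (j := j) (fun i hi => (Finset.mem_filter.1 hi).2.1) fun hne => ?_
    obtain ⟨i, hi, hmin⟩ := below.exists_min_image z hne
    refine ⟨i, hi, fun l hl hli => ?_⟩
    by_contra hlN
    obtain ⟨hj, hxi, hzi⟩ := (Finset.mem_filter.1 hi).2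
    obtain ⟨-, hxl, hzl⟩ := (Finset.mem_filter.1 hl).2
    have h1 := htie i j hj l hlN hli hxi.symm (hxl.trans hxi.symm)
    rw [abs_sub_comm, abs_of_pos (by linarith), abs_sub_comm,
      abs_of_nonneg (sub_nonneg.2 (hmin l hl))] at h1
    linarith
  have habove : above.card ≤ k := by
    refine h.card_le (j := j) (fun i hi => (Finset.mem_filter.1 hi).2.1) fun hne => ?_
    obtain ⟨i, hi, hmax⟩ := above.exists_max_image z hne
    refine ⟨i, hi, fun l hl hli => ?_⟩
    by_contra hlN
    obtain ⟨hj, hxi, hzi⟩ := (Finset.mem_filter.1 hi).2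
    obtain ⟨-, hxl, hzl⟩ := (Finset.mem_filter.1 hl).2
    have h1 := htie i j hj l hlN hli hxi.symm (hxl.trans hxi.symm)
    rw [abs_of_pos (by linarith), abs_of_nonneg (sub_nonneg.2 (hmax l hl))] at h1
    linarith
  have hcone : ∀ u ∈ T, (cone u).card ≤ k := by
    intro u _
    refine h.card_le (j := j) (fun i hi => (Finset.mem_filter.1 hi).2.1) fun hne => ?_
    obtain ⟨i, hi, hmax⟩ := (cone u).exists_max_image (fun i => ‖x i - x j‖) hne
    refine ⟨i, hi, fun l hl hli => ?_⟩
    by_contra hlN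
    obtain ⟨hj, hxi, hui⟩ := (Finset.mem_filter.1 hi).2
    obtain ⟨-, hxl, hul⟩ := (Finset.mem_filter.1 hl).2
    have h1 := h.nearest i j hj l hlN hli
    have h2 : ‖(x i - x j) - (x l - x j)‖ < ‖x i - x j‖ := by
      refine norm_sub_lt_of_norm_normalize_sub_lt (sub_ne_zero.2 hxl) (hmax l hl) ?_
      rw [← dist_eq_norm]
      calc _ ≤ _ := dist_triangle_right _ _ u
        _ < 1 / 2 + 1 / 2 := add_lt_add hui hul
        _ = 1 := by norm_num
    rw [sub_sub_sub_cancel_right, ← dist_eq_norm, ← dist_eq_norm] at h2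
    linarith
  have hcover : (Finset.univ.filter fun i => j ∈ N i) ⊆ below ∪ above ∪ T.biUnion cone := by
    intro i hi
    have hij := (Finset.mem_filter.1 hi).2
    simp only [Finset.mem_union, Finset.mem_biUnion]
    by_cases hx : x i = x j
    · left
      rcases lt_or_gt_of_ne (hz.ne (hmem i hij)) with hlt | hlt
      · exact Or.inl (Finset.mem_filter.2 ⟨Finset.mem_univ i, hij, hx, hlt⟩)
      · exact Or.inr (Finset.mem_filter.2 ⟨Finset.mem_univ i, hij, hx, hlt⟩)
    · right
      have hnorm : ‖x i - x j‖⁻¹ • (x i - x j) ∈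
          Metric.sphere (0 : EuclideanSpace ℝ (Fin d)) 1 := by
        rw [mem_sphere_zero_iff_norm, norm_smul, norm_inv, norm_norm,
          inv_mul_cancel₀ (norm_ne_zero_iff.2 (sub_ne_zero.2 hx))]
      obtain ⟨u, huT, hu⟩ := Set.mem_iUnion₂.1 (hT hnorm)
      exact ⟨u, huT, Finset.mem_filter.2 ⟨Finset.mem_univ i, hij, hx, hu⟩⟩
  calc _ ≤ _ := Finset.card_le_card hcover
    _ ≤ (below ∪ above).card + (T.biUnion cone).card := Finset.card_union_le _ _
    _ ≤ (below.card + above.card) + ∑ u ∈ T, (cone u).card :=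
        add_le_add (Finset.card_union_le _ _) Finset.card_biUnion_le
    _ ≤ (k + k) + ∑ _u ∈ T, k := by gcongr with u hu; exact hcone u hu
    _ = _ := by rw [Finset.sum_const, smul_eq_mul]; ring

end Cones

/-! ### Nearest-neighbour regression -/

section NearestNeighbors

variable {n : ℕ}

/-- The weight matrix of the `k`-NN estimate. -/
noncomputable def knnWeight (k : ℕ) (N : Fin n → Finset (Fin n)) (i j : Fin n) : ℝ :=
  if j ∈ N i then 1 / (k : ℝ) else 0

theorem knnEstimate_eq_sum (N : Fin n → Finset (Fin n)) (k : ℕ) (y : Fin n → ℝ) (i : Fin n) :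
    knnEstimate N k y i = ∑ j, knnWeight k N i j * y j := by
  simp [knnEstimate, knnWeight, ite_mul, Finset.sum_ite_mem, Finset.mul_sum]

theorem IsNeighborSystem.isSmoother {d k : ℕ} {x : Fin n → EuclideanSpace ℝ (Fin d)}
    {N : Fin n → Finset (Fin n)} (h : IsNeighborSystem x k N) (hk : 1 ≤ k) {c : ℕ} (hc : 1 ≤ c)
    (hcol : ∀ j, (Finset.univ.filter fun i => j ∈ N i).card ≤ c * k) :
    IsSmoother (c : ℝ) (knnWeight k N) where
  nonneg i j := by unfold knnWeight; positivity
  diag i := by simp [knnWeight, h.notMem_self i]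
  row_le i := by
    have hk0 : (k : ℝ) ≠ 0 := by positivity
    simp [knnWeight, h.card_eq i, hk0]
  col_le j := by
    have hk0 : (0 : ℝ) < k := by positivity
    have h1 : ((Finset.univ.filter fun i => j ∈ N i).card : ℝ) ≤ c * k := mod_cast hcol j
    simp only [knnWeight]
    rw [← Finset.sum_filter, Finset.sum_const, nsmul_eq_mul, mul_one_div, div_le_iff₀ hk0]
    exact h1
  one_le := mod_cast hc

variable {K : ℝ} {ν : Measure ℝ} [IsProbabilityMeasure ν]

theorem sum_sq_pos_of_ne_zero {mu : Fin n → ℝ} (hmu : mu ≠ 0) : 0 < ∑ i, mu i ^ 2 := by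
  obtain ⟨i, hi⟩ := Function.ne_iff.1 hmu
  exact Finset.sum_pos' (fun i _ => sq_nonneg _) ⟨i, Finset.mem_univ i, sq_pos_of_ne_zero hi⟩

/-- The interaction of signal and noise has the tail `signalTail`. -/
theorem IsSmoother.measureReal_cross_le {c : ℝ} {W : Fin n → Fin n → ℝ} (hW : IsSmoother c W)
    (hν : IsSubgaussianLaw K ν) (hK : 0 < K) (hn : 0 < n) (mu : Fin n → ℝ) {t : ℝ} (ht : 0 < t) :
    (Measure.pi fun _ : Fin n => ν).real
      {e | Fintype.card (Fin n) * (t / 8) ≤ |∑ j, residualCross W mu j * e j|} ≤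
      2 * signalTail (1 / (4096 * K * c ^ 2)) t mu := by
  have hn0 : (0 : ℝ) < n := mod_cast hn
  have hc : 0 < c := zero_lt_one.trans_le hW.one_le
  unfold signalTail
  split_ifs with hmu
  · have h0 : 0 < (n : ℝ) * (t / 8) := by positivity
    simp [hmu, residualCross, not_le.2 h0]
  · have hS := sum_sq_pos_of_ne_zero hmu
    refine (hν.measureReal_linear_le hK (b := 16 * c ^ 2 * ∑ i, mu i ^ 2) (by positivity)
      (hW.sum_residualCross_sq_le mu) (by positivity)).trans (le_of_eq ?_)
    rw [Fintype.card_fin]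
    congr 3
    field_simp
    norm_num

end NearestNeighbors

section Regression

/-- The deterministic comparison: since `ktilde` minimises the residual and `kstar` the mean
squared error, a gap of `t` forces the residual, less the mean square of the noise, to deviate
from the mean squared error by at least `t / 2` at one of the two. -/
theorem half_le_abs_of_argmin {n : ℕ} {F f : ℕ → ℝ} {s t : ℝ} {k₁ k₂ : ℕ}
    (h₁ : IsArgminNumber n F k₁) (h₂ : IsArgminNumber n f k₂) (ht : t ≤ |F k₁ - F k₂|) :
    ∃ k ∈ Finset.Icc 1 (n - 1), t / 2 ≤ |f k - s - F k| := by
  by_contra! hcon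
  have h3 := abs_lt.1 (hcon k₁ h₁.1)
  have h4 := abs_lt.1 (hcon k₂ h₂.1)
  rw [abs_of_nonpos (sub_nonpos.2 (h₁.2 k₂ h₂.1))] at ht
  linarith [h₂.2 k₁ h₁.1, h3.1, h3.2, h4.1, h4.2]

/-- A mixture over the values of a discrete variable that is independent of `Y`. -/
theorem measureReal_le_of_indepFun_discrete {Ω α β : Type*} [MeasurableSpace Ω]
    {P : Measure Ω} [IsProbabilityMeasure P] [Fintype α] [MeasurableSpace α]
    [MeasurableSingletonClass α] [MeasurableSpace β] {X : Ω → α} {Y : Ω → β} (hX : Measurable X)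
    (hY : AEMeasurable Y P) (hXY : IndepFun X Y P) {V : α → Prop} {D : α → Set β}
    (hD : ∀ a, MeasurableSet (D a)) {r : ℝ} (hr : 0 ≤ r)
    (h : ∀ a, V a → (P.map Y).real (D a) ≤ r) :
    P.real {ω | V (X ω) ∧ Y ω ∈ D (X ω)} ≤ r := by
  classical
  calc P.real {ω | V (X ω) ∧ Y ω ∈ D (X ω)}
      ≤ P.real (⋃ a ∈ Finset.univ.filter V, (X ⁻¹' {a} ∩ Y ⁻¹' D a)) := by
        refine measureReal_mono (fun ω hω => ?_) (measure_ne_top _ _)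
        exact Set.mem_iUnion₂.2 ⟨X ω, by simpa using hω.1, rfl, hω.2⟩
    _ ≤ ∑ a ∈ Finset.univ.filter V, P.real (X ⁻¹' {a} ∩ Y ⁻¹' D a) :=
        measureReal_biUnion_finset_le _ _
    _ ≤ ∑ a ∈ Finset.univ.filter V, P.real (X ⁻¹' {a}) * r := by
        refine Finset.sum_le_sum fun a ha => ?_
        have h1 := h a (Finset.mem_filter.1 ha).2
        rw [measureReal_def,
          hXY.measure_inter_preimage_eq_mul _ _ (measurableSet_singleton a) (hD a),
          ENNReal.toReal_mul]
        rw [measureReal_def, Measure.map_apply_of_aemeasurable hY (hD a)] at h1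
        exact mul_le_mul_of_nonneg_left h1 ENNReal.toReal_nonneg
    _ ≤ ∑ a, P.real (X ⁻¹' {a}) * r :=
        Finset.sum_le_sum_of_subset_of_nonneg (Finset.subset_univ _) fun _ _ _ => by positivity
    _ = r := by
        rw [← Finset.sum_mul, sum_measureReal_preimage_singleton _ fun a _ =>
          hX (measurableSet_singleton a)]
        simp

namespace IsKNNRegression

variable {Ω : Type*} [MeasurableSpace Ω] {P : Measure Ω} {d n : ℕ}
  {K : ℝ} {x : Fin n → EuclideanSpace ℝ (Fin d)} {m : EuclideanSpace ℝ (Fin d) → ℝ}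
  {ε : Fin n → Ω → ℝ} {N : Ω → ℕ → Fin n → Finset (Fin n)} {kstar ktilde : Ω → ℕ}

theorem aemeasurable_noise (h : IsKNNRegression P K x m ε N kstar ktilde) (i : Fin n) :
    AEMeasurable (ε i) P :=
  (h.identDistrib i i).aemeasurable_fst

theorem isSubgaussianLaw (h : IsKNNRegression P K x m ε N kstar ktilde) (i : Fin n) :
    IsSubgaussianLaw K (P.map (ε i)) where
  mean_zero := by
    rw [integral_map (h.aemeasurable_noise i) (by fun_prop)]
    exact h.mean_zero i
  integrable_exp :=
    (integrable_map_measure (by fun_prop) (h.aemeasurable_noise i)).2 (h.integrable_exp i)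
  exp_le := by
    rw [integral_map (h.aemeasurable_noise i) (by fun_prop)]
    exact h.exp_le i

variable [IsProbabilityMeasure P]

theorem map_noise_eq_pi (h : IsKNNRegression P K x m ε N kstar ktilde) (i : Fin n) :
    P.map (fun ω j => ε j ω) = Measure.pi fun _ => P.map (ε i) := by
  rw [(iIndepFun_iff_map_fun_eq_pi_map h.aemeasurable_noise).1 h.indep]
  congr
  ext1 j
  exact (h.identDistrib j i).map_eq

theorem knnMSE_eq (h : IsKNNRegression P K x m ε N kstar ktilde) (i₀ : Fin n)
    (M : ℕ → Fin n → Finset (Fin n)) (k : ℕ) :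
    knnMSE P (fun i => m (x i)) ε M k = (1 / (n : ℝ)) *
      ∫ e, ∑ i, (m (x i) - ∑ j, knnWeight k (M k) i j * (m (x j) + e j)) ^ 2
        ∂(Measure.pi fun _ : Fin n => P.map (ε i₀)) := by
  rw [← h.map_noise_eq_pi i₀, integral_map (aemeasurable_pi_lambda _ h.aemeasurable_noise)
    (Measurable.aestronglyMeasurable (by fun_prop)), ← integral_const_mul]
  simp only [knnMSE, knnEstimate_eq_sum]

/-- The tail bound, with `c` as in `exists_card_filter_mem_neighbors_le`. -/
theorem measureReal_mseGap_le (h : IsKNNRegression P K x m ε N kstar ktilde) (hK : 0 < K)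
    (hn : 2 ≤ n) {c : ℕ} (hc : 1 ≤ c)
    (hcol : ∀ k (M : Fin n → Finset (Fin n)), IsNeighborSystem x k M →
      ∀ j, (Finset.univ.filter fun i => j ∈ M i).card ≤ c * k) {t : ℝ} (ht : 0 ≤ t) :
    P.real {ω | t ≤ mseGap P (fun i => m (x i)) ε N kstar ktilde ω} ≤
      4 * (n : ℝ) * Real.exp (-((n : ℝ) *
        min (1 / (196608 * K ^ 2 * (c : ℝ) ^ 2) * t ^ 2) (1 / (256 * K * c) * t))) +
        4 * (n : ℝ) * signalTail (1 / (4096 * K * (c : ℝ) ^ 2)) t (fun i => m (x i)) := by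
  have hn0 : (2 : ℝ) ≤ n := mod_cast hn
  have hsig0 : 0 ≤ signalTail (1 / (4096 * K * (c : ℝ) ^ 2)) t (fun i => m (x i)) := by
    unfold signalTail
    split_ifs <;> positivity
  -- At `t = 0` the right-hand side is at least `1`.
  rcases ht.eq_or_lt with rfl | ht
  · have h1 := measureReal_le_one (μ := P)
      (s := {ω | 0 ≤ mseGap P (fun i => m (x i)) ε N kstar ktilde ω})
    simp only [mul_zero, ne_eq, OfNat.ofNat_ne_zero, not_false_eq_true, zero_pow, min_self,
      neg_zero, Real.exp_zero, mul_one]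
    nlinarith [mul_nonneg (by positivity : 0 ≤ 4 * (n : ℝ)) hsig0]
  let i₀ : Fin n := ⟨0, by omega⟩
  have := Measure.isProbabilityMeasure_map (h.aemeasurable_noise i₀)
  set mu : Fin n → ℝ := fun i => m (x i) with hmu
  set π := Measure.pi fun _ : Fin n => P.map (ε i₀) with hπ
  set r := 4 * Real.exp (-((n : ℝ) *
        min (1 / (196608 * K ^ 2 * (c : ℝ) ^ 2) * t ^ 2) (1 / (256 * K * c) * t))) +
        2 * signalTail (1 / (4096 * K * (c : ℝ) ^ 2)) t mu with hr
  have hr0 : 0 ≤ r := by positivity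
  -- The noise vectors for which the residual of a fixed neighbour system deviates by `t / 2`.
  let D : ℕ → (Fin n → Finset (Fin n)) → Set (Fin n → ℝ) := fun k M =>
    {e | (n : ℝ) * (4 * (t / 8)) ≤
      |∑ i, (mu i + e i - ∑ j, knnWeight k M i j * (mu j + e j)) ^ 2 - ∑ i, e i ^ 2 -
        ∫ e, ∑ i, (mu i - ∑ j, knnWeight k M i j * (mu j + e j)) ^ 2 ∂π|}
  have hDmeas : ∀ k M, MeasurableSet (D k M) := fun k M =>
    measurableSet_le measurable_const (by fun_prop)
  have hD : ∀ k ∈ Finset.Icc 1 (n - 1), ∀ M, IsNeighborSystem x k M → π.real (D k M) ≤ r := by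
    intro k hk M hM
    have hW := hM.isSmoother (Finset.mem_Icc.1 hk).1 hc (hcol k M hM)
    have h1 := hW.measureReal_residual_sub_integral_le (h.isSubgaussianLaw i₀) hK mu
      (u := t / 8) (by positivity)
      (hW.measureReal_cross_le (h.isSubgaussianLaw i₀) hK (by omega) mu ht)
    rw [Fintype.card_fin] at h1
    refine h1.trans (le_of_eq ?_)
    rw [hr]
    congr 5
    congr 1 <;> field_simp <;> norm_num
  let E : ℕ → Set Ω := fun k => {ω | IsNeighborSystem x k (N ω k) ∧ (fun i => ε i ω) ∈ D k (N ω k)}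
  have hE : ∀ k ∈ Finset.Icc 1 (n - 1), P.real (E k) ≤ r := by
    intro k hk
    have hNk : Measurable fun M : ℕ → Fin n → Finset (Fin n) => M k := measurable_pi_apply k
    refine measureReal_le_of_indepFun_discrete (hNk.comp h.measurable_N)
      (aemeasurable_pi_lambda _ h.aemeasurable_noise) (h.indep_N.comp hNk measurable_id)
      (V := fun M => IsNeighborSystem x k M) (hDmeas k) hr0 fun M hM => ?_
    rw [h.map_noise_eq_pi i₀]
    exact hD k hk M hM
  have hsub : {ω | t ≤ mseGap P mu ε N kstar ktilde ω} ≤ᵐ[P] ⋃ k ∈ Finset.Icc 1 (n - 1), E k := by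
    filter_upwards [h.neighbors, h.argmin_kstar, h.argmin_ktilde] with ω h1 h2 h3 hω
    obtain ⟨k, hk, hle⟩ := half_le_abs_of_argmin (s := 1 / (n : ℝ) * ∑ i, ε i ω ^ 2) h2 h3 hω
    refine Set.mem_iUnion₂.2 ⟨k, hk, h1 k hk, ?_⟩
    simp only [h.knnMSE_eq i₀, looResidual, knnEstimate_eq_sum] at hle
    rw [← mul_sub, ← mul_sub, abs_mul, abs_of_nonneg (by positivity), one_div_mul_eq_div,
      le_div_iff₀ (by positivity)] at hle
    refine le_trans (le_of_eq ?_) hle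
    ring
  calc P.real {ω | t ≤ mseGap P mu ε N kstar ktilde ω}
      ≤ P.real (⋃ k ∈ Finset.Icc 1 (n - 1), E k) :=
        ENNReal.toReal_mono (measure_ne_top _ _) (measure_mono_ae hsub)
    _ ≤ ∑ k ∈ Finset.Icc 1 (n - 1), P.real (E k) := measureReal_biUnion_finset_le _ _
    _ ≤ ∑ _k ∈ Finset.Icc 1 (n - 1), r := Finset.sum_le_sum hE
    _ = ((n - 1 : ℕ) : ℝ) * r := by simp
    _ ≤ n * r := by gcongr; omega
    _ ≤ _ := by
        rw [hr]
        nlinarith [mul_nonneg (by positivity : 0 ≤ (n : ℝ)) hsig0]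

end IsKNNRegression

/-- The two tails at `t = L √(log n / n)`, for `L` large and `‖μ‖² ≤ M n`. -/
theorem tail_le_rpow_neg {A B C M p L : ℝ} (hA : 0 < A) (hB : 0 < B) (hC : 0 < C) (hL : 1 ≤ L)
    (hLA : |p| + 4 ≤ A * L) (hLB : |p| + 4 ≤ B * L) (hLC : (|p| + 4) * max M 1 ≤ C * L) {n : ℕ}
    (hn : 2 ≤ n) {mu : Fin n → ℝ} (hmu : ∑ i, mu i ^ 2 ≤ M * n) {t : ℝ}
    (ht : t = L * √(Real.log n / n)) :
    4 * (n : ℝ) * Real.exp (-((n : ℝ) * min (A * t ^ 2) (B * t))) +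
      4 * (n : ℝ) * signalTail C t mu ≤ (n : ℝ) ^ (-p) := by
  have hn2 : (2 : ℝ) ≤ n := mod_cast hn
  have hn0 : (0 : ℝ) < n := by linarith
  set l := Real.log n with hl
  have hl0 : 0 ≤ l := Real.log_nonneg (by linarith)
  have hln : l / n ≤ 1 := (div_le_one hn0).2 (Real.log_le_self hn0.le)
  have ht2 : n * t ^ 2 = L ^ 2 * l := by
    rw [ht, mul_pow, Real.sq_sqrt (by positivity)]
    field_simp
  have hLL : L ≤ L ^ 2 := by nlinarith
  set q := |p| + 4 with hq
  have hq0 : 0 ≤ q := by positivity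
  have h1 : q * l ≤ n * min (A * t ^ 2) (B * t) := by
    rw [mul_min_of_nonneg _ _ hn0.le]
    refine le_min ?_ ?_
    · calc q * l ≤ (A * L ^ 2) * l := by gcongr; exact hLA.trans (by gcongr)
        _ = A * (n * t ^ 2) := by rw [ht2]; ring
        _ = _ := by ring
    · have h2 : l / n ≤ √(l / n) := Real.le_sqrt_of_sq_le (by
        have : 0 ≤ l / n := by positivity
        nlinarith)
      calc q * l ≤ (B * L) * l := by gcongr
        _ = n * (B * (L * (l / n))) := by field_simp
        _ ≤ n * (B * t) := by rw [ht]; gcongr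
  have h2 : signalTail C t mu ≤ Real.exp (-(q * l)) := by
    unfold signalTail
    split_ifs with hmu0
    · positivity
    · have hS := sum_sq_pos_of_ne_zero hmu0
      refine Real.exp_le_exp.2 (neg_le_neg ?_)
      rw [le_div_iff₀ hS]
      calc q * l * ∑ i, mu i ^ 2 ≤ q * l * (max M 1 * n) := by
            gcongr
            exact hmu.trans (by gcongr; exact le_max_left _ _)
        _ = (q * max M 1) * (l * n) := by ring
        _ ≤ (C * L ^ 2) * (l * n) :=
            mul_le_mul_of_nonneg_right (hLC.trans (by gcongr)) (by positivity)
        _ = C * n * (n * t ^ 2) := by rw [ht2]; ring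
        _ = _ := by ring
  -- The prefactor `8 n` costs at most a factor `n ^ 4`.
  have h3 : 8 * (n : ℝ) ≤ Real.exp (4 * l) := by
    rw [hl, show 4 * Real.log n = ((4 : ℕ) : ℝ) * Real.log n by norm_num, Real.exp_nat_mul,
      Real.exp_log hn0]
    nlinarith [pow_le_pow_left₀ (by norm_num) hn2 3]
  calc _ ≤ 4 * (n : ℝ) * Real.exp (-(q * l)) + 4 * (n : ℝ) * Real.exp (-(q * l)) := by gcongr
    _ = 8 * (n : ℝ) * Real.exp (-(q * l)) := by ring
    _ ≤ Real.exp (4 * l) * Real.exp (-(q * l)) := by gcongr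
    _ = Real.exp (l * -|p|) := by rw [← Real.exp_add, hq]; congr 1; ring
    _ ≤ Real.exp (l * -p) := by gcongr; exact le_abs_self p
    _ = (n : ℝ) ^ (-p) := by rw [Real.rpow_def_of_pos hn0]

end Regression

theorem theorem1 (d : ℕ) (K : ℝ) (hK : 0 < K) :
    (∃ A B C : ℝ, 0 < A ∧ 0 < B ∧ 0 < C ∧
      ∀ (n : ℕ), 2 ≤ n →
      ∀ (Ω : Type*) [MeasurableSpace Ω] (P : Measure Ω) [IsProbabilityMeasure P]
        (x : Fin n → EuclideanSpace ℝ (Fin d)) (m : EuclideanSpace ℝ (Fin d) → ℝ)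
        (ε : Fin n → Ω → ℝ) (N : Ω → ℕ → Fin n → Finset (Fin n)) (kstar ktilde : Ω → ℕ),
        IsKNNRegression P K x m ε N kstar ktilde →
        ∀ t : ℝ, 0 ≤ t →
          P.real {ω | t ≤ mseGap P (fun i => m (x i)) ε N kstar ktilde ω} ≤
            4 * (n : ℝ) * Real.exp (-((n : ℝ) * min (A * t ^ 2) (B * t))) +
              4 * (n : ℝ) * signalTail C t (fun i => m (x i))) ∧
    (∀ M p : ℝ, ∃ L : ℝ, 0 < L ∧
      ∀ (n : ℕ), 2 ≤ n →
      ∀ (Ω : Type*) [MeasurableSpace Ω] (P : Measure Ω) [IsProbabilityMeasure P]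
        (x : Fin n → EuclideanSpace ℝ (Fin d)) (m : EuclideanSpace ℝ (Fin d) → ℝ)
        (ε : Fin n → Ω → ℝ) (N : Ω → ℕ → Fin n → Finset (Fin n)) (kstar ktilde : Ω → ℕ),
        IsKNNRegression P K x m ε N kstar ktilde →
        ∑ i, m (x i) ^ 2 ≤ M * (n : ℝ) →
          P.real {ω | L * Real.sqrt (Real.log n / n) ≤
              mseGap P (fun i => m (x i)) ε N kstar ktilde ω} ≤ (n : ℝ) ^ (-p)) := by
  obtain ⟨c, hc, hcol⟩ := exists_card_filter_mem_neighbors_le d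
  have hc0 : (0 : ℝ) < c := by positivity
  have hA : 0 < 1 / (196608 * K ^ 2 * (c : ℝ) ^ 2) := by positivity
  have hB : 0 < 1 / (256 * K * (c : ℝ)) := by positivity
  have hC : 0 < 1 / (4096 * K * (c : ℝ) ^ 2) := by positivity
  refine ⟨⟨_, _, _, hA, hB, hC, ?_⟩, fun M p => ?_⟩
  · intro n hn Ω _ P _ x m ε N kstar ktilde h t ht
    exact h.measureReal_mseGap_le hK hn hc (fun k M => hcol n k x M) ht
  · set A := 1 / (196608 * K ^ 2 * (c : ℝ) ^ 2) with hAdef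
    set B := 1 / (256 * K * (c : ℝ)) with hBdef
    set C := 1 / (4096 * K * (c : ℝ) ^ 2) with hCdef
    have hq0 : 0 ≤ |p| + 4 := by positivity
    have hA0 : 0 ≤ (|p| + 4) / A := by positivity
    have hB0 : 0 ≤ (|p| + 4) / B := by positivity
    have hC0 : 0 ≤ (|p| + 4) * max M 1 / C :=
      div_nonneg (mul_nonneg hq0 (zero_le_one.trans (le_max_right M 1))) hC.le
    set L := 1 + (|p| + 4) / A + (|p| + 4) / B + (|p| + 4) * max M 1 / C with hLdef
    have hL : 1 ≤ L := by linarith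
    refine ⟨L, by linarith, ?_⟩
    intro n hn Ω _ P _ x m ε N kstar ktilde h hmu
    refine (h.measureReal_mseGap_le hK hn hc (fun k M => hcol n k x M) (by positivity)).trans
      (tail_le_rpow_neg hA hB hC hL ?_ ?_ ?_ hn hmu rfl)
    · exact (div_le_iff₀' hA).1 (by linarith)
    · exact (div_le_iff₀' hB).1 (by linarith)
    · exact (div_le_iff₀' hC).1 (by linarith)
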